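/- **Setting.** $\|\cdot\|$ is the matrix 2-norm and $\kappa=\sigma_{\max}/\sigma_{\min}$ the 2-condition number (finite exactly for full column rank). Let $0<\varepsilon_h\le\varepsilon_\ell$ be the unit roundoffs of a high and a low precision. Computations in a precision with unit roundoff $u$ follow the standard model of floating-point arithmetic: each computed elementary operation ($+,-,\times,/,\sqrt{\cdot}$), and each cast to that precision, returns the exact result times $1+\delta$ for some $|\delta|\le u$; sums may be accumulated in any order. Let $\mathcal X=[X_1\,\cdots\,X_p]\in\mathbb R^{m\times ps}$ with blocks $X_k\in\mathbb R^{m\times s}$ ($p,s\ge 1$), and $\mathcal X_k=[X_1\,\cdots\,X_k]$; likewise $\mathcal Q_k$, and $\mathcal R_k$ is the leading $ks\times ks$ submatrix of $\mathcal R$. A *dimensional constant* is a value $c(m,ps)$ of a polynomial $c$ in two variables. An intraorthogonalization routine $\mathrm{IO}$ maps each $X\in\mathbb R^{m\times s}$ to a pair $[Q,R]$, $Q\in\mathbb R^{m\times s}$, $R\in\mathbb R^{s\times s}$. **Two-precision BCGS-PIPI+** sets $[Q_1,R_{11}]=\mathrm{IO}(X_1)$ and then, for $k=2,\dots,p$: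 1. $S_{1:k-1,k}=\mathcal Q_{k-1}^TX_k$ (in $\varepsilon_\ell$); $\Omega_k=X_k^TX_k$ and $S_{kk}=\mathrm{chol}(\Omega_k-S_{1:k-1,k}^TS_{1:k-1,k})$ (in $\varepsilon_h$); $V_k=X_k-\mathcal Q_{k-1}S_{1:k-1,k}$ (in $\varepsilon_\ell$); $U_k=V_kS_{kk}^{-1}$ (by substitution in $\varepsilon_h$, then cast to $\varepsilon_\ell$); 2. $T_{1:k-1,k}=\mathcal Q_{k-1}^TU_k$ (in $\varepsilon_\ell$); $P_k=U_k^TU_k$ and $T_{kk}=\mathrm{chol}(P_k-T_{1:k-1,k}^TT_{1:k-1,k})$ (in $\varepsilon_h$); $W_k=U_k-\mathcal Q_{k-1}T_{1:k-1,k}$ (in $\varepsilon_\ell$); $Q_k=W_kT_{kk}^{-1}$ (by substitution in $\varepsilon_h$, then cast to $\varepsilon_\ell$); 3. $R_{1:k-1,k}=S_{1:k-1,k}+T_{1:k-1,k}S_{kk}$ (in $\varepsilon_\ell$, with $S_{kk}$ cast to $\varepsilon_\ell$); $R_{kk}=T_{kk}S_{kk}$ (in $\varepsilon_h$, then cast to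 $\varepsilon_\ell$). The blocks of $\mathcal R$ below the block diagonal are zero. Bars denote computed quantities. **Statement.** For all dimensional constants $b_E,b_D,b_N,b_M$ there are dimensional constants $C,c_E,c_D,c_N,c_L$ such that the following holds for all $m,p,s,\varepsilon_\ell,\varepsilon_h$ and all $\mathcal X\in\mathbb R^{m\times ps}$ of full column rank with $$C\,\varepsilon_\ell\,\kappa^2(\mathcal X)\le\tfrac12 .$$ Suppose that for all $X\in\mathbb R^{m\times s}$ of full column rank with $\kappa(X)\le\kappa(\mathcal X)$ the output $[\bar Q,\bar R]=\mathrm{IO}(X)$ satisfies $$\|\bar R^T\bar R-X^TX\|\le b_E\varepsilon_\ell\|X\|^2,\qquad \|\bar Q\bar R-X\|\le b_D\varepsilon_\ell\|X\|,\qquad \|I-\bar Q^T\bar Q\|\le\frac{b_N\varepsilon_\ell}{1-b_M\varepsilon_\ell\kappa^2(X)} .$$ Then no execution of two-precision BCGS-PIPI+ on $\mathcal X$ breaks down (all computed pivots in the Cholesky factorizations are positive), and for every execution the computed $\bar{\mathcal Q},\bar{\mathcal R}$ satisfy, for all $k\in\{1,\dots,p\}$, $$\|\bar{\mathcal R}_k^T\bar{\mathcal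 R}_k-\mathcal X_k^T\mathcal X_k\|\le c_E\varepsilon_\ell\|\mathcal X_k\|^2,\qquad \|\bar{\mathcal Q}_k\bar{\mathcal R}_k-\mathcal X_k\|\le c_D\varepsilon_\ell\|\mathcal X_k\|,$$ $$\|I-\bar{\mathcal Q}_k^T\bar{\mathcal Q}_k\|\le\frac{c_N\varepsilon_\ell}{1-C\varepsilon_\ell\kappa^2(\mathcal X_k)}\le c_L\varepsilon_\ell .$$ -/

import Mathlib

open scoped Matrix Matrix.Norms.L2Operator

namespace BlockGS

noncomputable section

/-! ### Floating-point arithmetic: the standard model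

All computed quantities are described by relations: `FlX u ... z` says that `z` is a possible
result of the computation in an arithmetic with unit roundoff `u`.  No order of summation is
fixed, so sequential, blocked and tree-like (distributed) reductions are all covered. -/

/-- `y` is a possible rounding of the real number `x`: `y = x (1 + δ)` with `|δ| ≤ u`.
The computed value of `x op y`, for an elementary operation, is a rounding of the exact value;
a cast to the format with unit roundoff `u` is a rounding as well. -/
def FlRound (u x y : ℝ) : Prop := ∃ δ : ℝ, |δ| ≤ u ∧ y = x * (1 + δ)

/-- `c` is a possible computed sum of the numbers in the multiset, added in some order along some
binary tree, one rounding per addition. The empty sum is `0`, and a one-term sum is exact. -/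
inductive FlSum (u : ℝ) : Multiset ℝ → ℝ → Prop
  | zero : FlSum u 0 0
  | single (a : ℝ) : FlSum u {a} a
  | add {s t : Multiset ℝ} {a b c : ℝ} (hs : s ≠ 0) (ht : t ≠ 0)
      (ha : FlSum u s a) (hb : FlSum u t b) (hc : FlRound u (a + b) c) : FlSum u (s + t) c

/-- `c` is a computed value of `∑ i ∈ I, x i * y i`. -/
def FlDot {ι : Type} (u : ℝ) (I : Finset ι) (x y : ι → ℝ) (c : ℝ) : Prop :=
  ∃ q : ι → ℝ, (∀ i ∈ I, FlRound u (x i * y i) (q i)) ∧ FlSum u (I.val.map q) c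

/-- `c` is a computed value of `a + ∑ i ∈ I, x i * y i`. -/
def FlAddDot {ι : Type} (u a : ℝ) (I : Finset ι) (x y : ι → ℝ) (c : ℝ) : Prop :=
  ∃ q : ι → ℝ, (∀ i ∈ I, FlRound u (x i * y i) (q i)) ∧ FlSum u (a ::ₘ I.val.map q) c

/-- `c` is a computed value of `a - ∑ i ∈ I, x i * y i`. -/
def FlSubDot {ι : Type} (u a : ℝ) (I : Finset ι) (x y : ι → ℝ) (c : ℝ) : Prop :=
  ∃ q : ι → ℝ, (∀ i ∈ I, FlRound u (x i * y i) (q i)) ∧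
    FlSum u (a ::ₘ I.val.map (fun i => -q i)) c

/-- Cholesky factorization `A ≈ Rᵀ R` executed with unit roundoff `u`, with computed upper
triangular factor `R` and computed pivots `d`. Only the upper triangle of `A` is read. The
factorization breaks down if some pivot is not positive (the values that `√` and `/` take in that
case are a mere convention; see `PIPIRun.NoBreakdown`). -/
structure FlChol {s : ℕ} (u : ℝ) (A R : Matrix (Fin s) (Fin s) ℝ) (d : Fin s → ℝ) : Prop where
  lower : ∀ i j, j < i → R i j = 0
  pivot : ∀ j, FlSubDot u (A j j) (Finset.Iio j) (fun l => R l j) (fun l => R l j) (d j)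
  diag : ∀ j, FlRound u (√(d j)) (R j j)
  off : ∀ i j, i < j → ∃ t, FlSubDot u (A i j) (Finset.Iio i) (fun l => R l i) (fun l => R l j) t ∧
    FlRound u (t / R i i) (R i j)

/-- `U = V S⁻¹` for an upper triangular `S`, by substitution along each row of `V` with unit
roundoff `εh`; the result is then cast to the format with unit roundoff `εl`. -/
def FlRightSolve {m s : ℕ} (εl εh : ℝ) (V : Matrix (Fin m) (Fin s) ℝ)
    (S : Matrix (Fin s) (Fin s) ℝ) (U : Matrix (Fin m) (Fin s) ℝ) : Prop :=
  ∃ Z : Matrix (Fin m) (Fin s) ℝ, ∀ r j,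
    (∃ t, FlSubDot εh (V r j) (Finset.Iio j) (fun l => Z r l) (fun l => S l j) t ∧
      FlRound εh (t / S j j) (Z r j)) ∧
    FlRound εl (Z r j) (U r j)

/-! ### Blocks, condition number, dimensional constants

A matrix with `p` block columns of width `s` has its columns indexed by `Fin p × Fin s`. -/

/-- The `k`-th block column. -/
def colBlock {m p s : ℕ} (X : Matrix (Fin m) (Fin p × Fin s) ℝ) (k : Fin p) :
    Matrix (Fin m) (Fin s) ℝ := fun r a => X r (k, a)

/-- The `k`-th diagonal block. -/
def diagBlock {p s : ℕ} (R : Matrix (Fin p × Fin s) (Fin p × Fin s) ℝ) (k : Fin p) :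
    Matrix (Fin s) (Fin s) ℝ := fun a b => R (k, a) (k, b)

/-- The indices of the columns in the block columns before the `k`-th one. -/
def prevCols {p : ℕ} (s : ℕ) (k : Fin p) : Finset (Fin p × Fin s) :=
  Finset.Iio k ×ˢ Finset.univ

/-- The matrix formed by the first `k` block columns. -/
def leadCols {m p s : ℕ} (X : Matrix (Fin m) (Fin p × Fin s) ℝ) (k : ℕ) (hk : k ≤ p) :
    Matrix (Fin m) (Fin k × Fin s) ℝ :=
  X.submatrix id (Prod.map (Fin.castLE hk) id)

/-- The leading principal submatrix of the first `k` block rows and block columns. -/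
def leadBlock {p s : ℕ} (R : Matrix (Fin p × Fin s) (Fin p × Fin s) ℝ) (k : ℕ) (hk : k ≤ p) :
    Matrix (Fin k × Fin s) (Fin k × Fin s) ℝ :=
  R.submatrix (Prod.map (Fin.castLE hk) id) (Prod.map (Fin.castLE hk) id)

/-- The columns are linearly independent, i.e. the 2-condition number is finite. -/
def HasFullColumnRank {m : ℕ} {n : Type} (X : Matrix (Fin m) n ℝ) : Prop :=
  LinearIndependent ℝ X.col

/-- The 2-condition number `σ_max(X) / σ_min(X)` of a matrix with `n ≥ 1` columns, and full column
rank (only used in that case); the singular values are numbered from `0` in decreasing order. -/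
def cond {m : ℕ} {n : Type} [Fintype n] [DecidableEq n] (X : Matrix (Fin m) n ℝ) : ℝ :=
  (Matrix.toEuclideanLin X).singularValues 0 /
    (Matrix.toEuclideanLin X).singularValues (Fintype.card n - 1)

/-- The value `c(m, ps)` of a dimensional constant `c`, a polynomial in two variables. -/
def dimConst (c : MvPolynomial (Fin 2) ℝ) (m p s : ℕ) : ℝ :=
  MvPolynomial.eval ![(m : ℝ), ((p * s : ℕ) : ℝ)] c

/-! ### Two-precision BCGS-PIPI+ -/

/-- A (deterministic) intraorthogonalization routine `[Q, R] = orth X`. -/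
abbrev IntraOrth (m s : ℕ) : Type :=
  Matrix (Fin m) (Fin s) ℝ → Matrix (Fin m) (Fin s) ℝ × Matrix (Fin s) (Fin s) ℝ

/-- An execution of two-precision BCGS-PIPI+ on `X` in floating-point arithmetic, with low
precision `εl` and high precision `εh`: the computed quantities and, for each line of the
algorithm, the statement that they result from executing it. The block index `k` runs over
`0, …, p - 1`; the loop is executed for `k ≥ 1`. -/
structure PIPIRun {m p s : ℕ} (εl εh : ℝ) (orth : IntraOrth m s)
    (X : Matrix (Fin m) (Fin p × Fin s) ℝ) where
  Q : Matrix (Fin m) (Fin p × Fin s) ℝ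
  R : Matrix (Fin p × Fin s) (Fin p × Fin s) ℝ
  S : Matrix (Fin p × Fin s) (Fin p × Fin s) ℝ
  T : Matrix (Fin p × Fin s) (Fin p × Fin s) ℝ
  V : Matrix (Fin m) (Fin p × Fin s) ℝ
  U : Matrix (Fin m) (Fin p × Fin s) ℝ
  W : Matrix (Fin m) (Fin p × Fin s) ℝ
  /-- `Ω k = X_kᵀ X_k` -/
  Ω : Fin p → Matrix (Fin s) (Fin s) ℝ
  /-- `P k = U_kᵀ U_k` -/
  P : Fin p → Matrix (Fin s) (Fin s) ℝ
  /-- the argument `Ω_k - S_{1:k-1,k}ᵀ S_{1:k-1,k}` of the first Cholesky factorization -/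
  A : Fin p → Matrix (Fin s) (Fin s) ℝ
  /-- the argument `P_k - T_{1:k-1,k}ᵀ T_{1:k-1,k}` of the second Cholesky factorization -/
  B : Fin p → Matrix (Fin s) (Fin s) ℝ
  /-- pivots of the first Cholesky factorization -/
  d : Fin p → Fin s → ℝ
  /-- pivots of the second Cholesky factorization -/
  e : Fin p → Fin s → ℝ
  /-- `S_kk` cast to low precision -/
  Slow : Fin p → Matrix (Fin s) (Fin s) ℝ
  first : ∀ k : Fin p, (k : ℕ) = 0 → (colBlock Q k, diagBlock R k) = orth (colBlock X k)
  S_off : ∀ k i : Fin p, i < k → ∀ a b : Fin s,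
    FlDot εl Finset.univ (fun r => Q r (i, a)) (fun r => X r (k, b)) (S (i, a) (k, b))
  Ω_eq : ∀ k : Fin p, 0 < (k : ℕ) → ∀ a b : Fin s,
    FlDot εh Finset.univ (fun r => X r (k, a)) (fun r => X r (k, b)) (Ω k a b)
  A_eq : ∀ k : Fin p, 0 < (k : ℕ) → ∀ a b : Fin s,
    FlSubDot εh (Ω k a b) (prevCols s k) (fun j => S j (k, a)) (fun j => S j (k, b)) (A k a b)
  S_diag : ∀ k : Fin p, 0 < (k : ℕ) → FlChol εh (A k) (diagBlock S k) (d k)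
  V_eq : ∀ k : Fin p, 0 < (k : ℕ) → ∀ (r : Fin m) (b : Fin s),
    FlSubDot εl (X r (k, b)) (prevCols s k) (fun j => Q r j) (fun j => S j (k, b)) (V r (k, b))
  U_eq : ∀ k : Fin p, 0 < (k : ℕ) →
    FlRightSolve εl εh (colBlock V k) (diagBlock S k) (colBlock U k)
  T_off : ∀ k i : Fin p, i < k → ∀ a b : Fin s,
    FlDot εl Finset.univ (fun r => Q r (i, a)) (fun r => U r (k, b)) (T (i, a) (k, b))
  P_eq : ∀ k : Fin p, 0 < (k : ℕ) → ∀ a b : Fin s,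
    FlDot εh Finset.univ (fun r => U r (k, a)) (fun r => U r (k, b)) (P k a b)
  B_eq : ∀ k : Fin p, 0 < (k : ℕ) → ∀ a b : Fin s,
    FlSubDot εh (P k a b) (prevCols s k) (fun j => T j (k, a)) (fun j => T j (k, b)) (B k a b)
  T_diag : ∀ k : Fin p, 0 < (k : ℕ) → FlChol εh (B k) (diagBlock T k) (e k)
  W_eq : ∀ k : Fin p, 0 < (k : ℕ) → ∀ (r : Fin m) (b : Fin s),
    FlSubDot εl (U r (k, b)) (prevCols s k) (fun j => Q r j) (fun j => T j (k, b)) (W r (k, b))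
  Q_eq : ∀ k : Fin p, 0 < (k : ℕ) →
    FlRightSolve εl εh (colBlock W k) (diagBlock T k) (colBlock Q k)
  Slow_eq : ∀ k : Fin p, 0 < (k : ℕ) → ∀ a b : Fin s, FlRound εl (S (k, a) (k, b)) (Slow k a b)
  R_off : ∀ k i : Fin p, i < k → ∀ a b : Fin s,
    FlAddDot εl (S (i, a) (k, b)) Finset.univ (fun c => T (i, a) (k, c)) (fun c => Slow k c b)
      (R (i, a) (k, b))
  R_diag : ∀ k : Fin p, 0 < (k : ℕ) → ∀ a b : Fin s, ∃ y,
    FlDot εh Finset.univ (fun c => T (k, a) (k, c)) (fun c => S (k, c) (k, b)) y ∧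
      FlRound εl y (R (k, a) (k, b))
  R_lower : ∀ k i : Fin p, k < i → ∀ a b : Fin s, R (i, a) (k, b) = 0

/-- No Cholesky factorization breaks down: all computed pivots are positive. -/
def PIPIRun.NoBreakdown {m p s : ℕ} {εl εh : ℝ} {orth : IntraOrth m s}
    {X : Matrix (Fin m) (Fin p × Fin s) ℝ} (run : PIPIRun εl εh orth X) : Prop :=
  ∀ k : Fin p, 0 < (k : ℕ) → ∀ j : Fin s, 0 < run.d k j ∧ 0 < run.e k j

end

end BlockGS

open scoped Matrix Matrix.Norms.L2Operator

set_option linter.unusedSectionVars false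

namespace BlockGS

/-! ### Rounding error bounds for sums and inner products -/

/-! The proof is a normwise perturbation argument in one error unit `η = g εl`, with `g` polynomial
in the dimensions. Write `Q` for the computed blocks before the current one, `X` for the current
block, `σ` for the smallest singular value of the whole input and `N` for the norm of the columns up
to and including `X`. Suppose that `Q` has loss of orthogonality `δ ≤ D η` and that `Q R` reproduces
the preceding columns with relative error at most `D η`.

One projection. Put `Y = X - Q S`. The Pythagorean identity `Yᵀ Y = Xᵀ X - Sᵀ S` fails only by a
multiple of `η N²` plus `δ ‖S‖²`. Moreover `‖Y y‖ ≥ (σ/2) ‖y‖` for any `S` whatsoever, because `Q S`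
is, up to the small residual, a combination of earlier columns of the input (`LowerBound.sub_mul`).
If `D η N² / σ²` is small, the matrix passed to Cholesky is therefore positive definite with a
margin of order `σ²`. This is where the square of the condition number enters. Cholesky then
succeeds (`FlChol.bound`), its factor `G` satisfies `Gᵀ G ≈ Yᵀ Y` and `‖G⁻¹‖ = O(1/σ)`, and `U ≈ Y
G⁻¹` is well conditioned with `‖Qᵀ U‖ = O((η N + δ ‖S‖)/σ)` (`FlPIP.project`).

Second projection. Its input `U` has norm and lower bound of order one, and `T ≈ Qᵀ U` is of size `D
η N/σ`. The inherited loss of orthogonality enters only through `δ ‖T‖ = O(D² η N/σ) η ≤ η`, so the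
new block is orthonormal, and orthogonal to `Q`, up to a multiple of `η` that does not involve `D`
(`FlPIP.project_twice`).

Each block thus adds a fixed number of units to both errors, and the induction
(`PIPIRun.Accurate.step`) closes with `D` proportional to `p s`; the condition on `κ` carries the
factor `D² g`. The bound for `Rᵀ R - Xᵀ X` follows from residual and orthogonality (`gram_bound`).
-/

theorem FlRound.abs_sub_le {u x y : ℝ} (h : FlRound u x y) : |y - x| ≤ u * |x| := by
  obtain ⟨δ, hδ, rfl⟩ := h
  rw [show x * (1 + δ) - x = δ * x by ring, abs_mul]
  gcongr

theorem FlRound.abs_le {u x y : ℝ} (h : FlRound u x y) : |y| ≤ (1 + u) * |x| := by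
  have h1 := h.abs_sub_le
  have h2 := abs_sub_abs_le_abs_sub y x
  linarith

/-- Each addition costs both operands one more factor `1 + u`. As neither operand is empty, the size
of either one plus one is at most the size of the union, so the exponent never exceeds the number of
terms, whatever the shape of the tree. -/
theorem FlSum.abs_sub_le {u : ℝ} (hu : 0 ≤ u) {s : Multiset ℝ} {c : ℝ} (h : FlSum u s c) :
    |c - s.sum| ≤ ((1 + u) ^ s.card - 1) * (s.map abs).sum := by
  induction h with
  | zero => simp
  | single a => simpa using mul_nonneg hu (abs_nonneg a)
  | @add s t a b c hs ht _ _ hc iha ihb =>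
    have hs' : 1 ≤ s.card := Multiset.card_pos.2 hs
    have ht' : 1 ≤ t.card := Multiset.card_pos.2 ht
    have hA := s.abs_sum_le_sum_abs
    have hB := t.abs_sum_le_sum_abs
    set A := (s.map abs).sum
    set B := (t.map abs).sum
    have hA0 : 0 ≤ A := (abs_nonneg _).trans hA
    have hB0 : 0 ≤ B := (abs_nonneg _).trans hB
    have h1 : (1 : ℝ) ≤ 1 + u := by linarith
    have hps : (1 + u) ^ (s.card + 1) ≤ (1 + u) ^ (s.card + t.card) :=
      pow_le_pow_right₀ h1 (by omega)
    have hpt : (1 + u) ^ (t.card + 1) ≤ (1 + u) ^ (s.card + t.card) :=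
      pow_le_pow_right₀ h1 (by omega)
    have hab : |a + b| ≤ (1 + u) ^ s.card * A + (1 + u) ^ t.card * B := by
      have e1 := abs_sub_abs_le_abs_sub a s.sum
      have e2 := abs_sub_abs_le_abs_sub b t.sum
      have e3 := abs_add_le a b
      linarith
    have h3 := hc.abs_sub_le
    have h4 : |c - (s.sum + t.sum)| ≤ |c - (a + b)| + |a - s.sum| + |b - t.sum| := by
      calc _ = |(c - (a + b)) + (a - s.sum) + (b - t.sum)| := by ring_nf
        _ ≤ _ := abs_add_three _ _ _
    rw [Multiset.sum_add, Multiset.map_add, Multiset.sum_add, Multiset.card_add]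
    calc |c - (s.sum + t.sum)|
        ≤ u * ((1 + u) ^ s.card * A + (1 + u) ^ t.card * B) + ((1 + u) ^ s.card - 1) * A
          + ((1 + u) ^ t.card - 1) * B := by
          have := mul_le_mul_of_nonneg_left hab hu
          linarith
      _ = ((1 + u) ^ (s.card + 1) - 1) * A + ((1 + u) ^ (t.card + 1) - 1) * B := by ring
      _ ≤ ((1 + u) ^ (s.card + t.card) - 1) * (A + B) := by
          rw [mul_add]; gcongr

/-- `g` bounds the relative error of inner products of length at most `h` with unit roundoff `u`. -/
structure DotBound (u g : ℝ) (h : ℕ) : Prop where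
  nonneg : 0 ≤ u
  le : u ≤ g
  pow_le : (1 + u) ^ (h + 2) - 1 ≤ g

/-- Gives both precisions the same bound, that of the larger roundoff `v`, through `exp x - 1 ≤ 2 x`
on `[0, 1]`. -/
theorem dotBound_of_le {u v : ℝ} {h : ℕ} (hu : 0 ≤ u) (huv : u ≤ v) (hv : (h + 2) * v ≤ 1) :
    DotBound u (2 * (h + 2) * v) h := by
  have hh : (0 : ℝ) ≤ h := h.cast_nonneg
  have hv0 : 0 ≤ v := hu.trans huv
  refine ⟨hu, by nlinarith, ?_⟩
  have h1 : (1 + u) ^ (h + 2) ≤ Real.exp ((h + 2) * v) := by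
    calc (1 + u) ^ (h + 2) ≤ (Real.exp v) ^ (h + 2) := by
          gcongr
          linarith [Real.add_one_le_exp v]
      _ = _ := by rw [← Real.exp_nat_mul]; push_cast; rfl
  have h0 : 0 ≤ (h + 2) * v := by positivity
  have h2 := Real.abs_exp_sub_one_le (x := (h + 2) * v) (by rwa [abs_of_nonneg h0])
  rw [abs_of_nonneg h0] at h2
  linarith [le_abs_self (Real.exp ((h + 2) * v) - 1)]

namespace DotBound

variable {u g : ℝ} {h : ℕ}

theorem nonneg' (hu : DotBound u g h) : 0 ≤ g := hu.nonneg.trans hu.le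

/-- The exponent `h + 2` in `DotBound` counts at most `h + 1` summands, including `a`, and one
rounding for each product. -/
theorem sum_aux (hu : DotBound u g h) {ι : Type} (I : Finset ι) (hI : I.card ≤ h) (a c : ℝ)
    (z q : ι → ℝ) (hq : ∀ i ∈ I, FlRound u (z i) (q i))
    (hc : FlSum u (a ::ₘ I.val.map q) c) :
    |c - (a + ∑ i ∈ I, z i)| ≤ g * (|a| + ∑ i ∈ I, |z i|) := by
  have h1 := hc.abs_sub_le hu.nonneg
  have e1 : (a ::ₘ I.val.map q).sum = a + ∑ i ∈ I, q i := by simp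
  have e2 : ((a ::ₘ I.val.map q).map abs).sum = |a| + ∑ i ∈ I, |q i| := by simp
  have e3 : (a ::ₘ I.val.map q).card = I.card + 1 := by simp
  rw [e1, e2, e3] at h1
  have hz : 0 ≤ ∑ i ∈ I, |z i| := Finset.sum_nonneg fun i _ => abs_nonneg _
  have h2 : ∑ i ∈ I, |q i| ≤ (1 + u) * ∑ i ∈ I, |z i| := by
    rw [Finset.mul_sum]; exact Finset.sum_le_sum fun i hi => (hq i hi).abs_le
  have h3 : |∑ i ∈ I, q i - ∑ i ∈ I, z i| ≤ u * ∑ i ∈ I, |z i| := by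
    rw [← Finset.sum_sub_distrib, Finset.mul_sum]
    exact (Finset.abs_sum_le_sum_abs _ _).trans
      (Finset.sum_le_sum fun i hi => (hq i hi).abs_sub_le)
  have hu0 := hu.nonneg
  have p1 : (1 : ℝ) ≤ (1 + u) ^ (I.card + 1) := one_le_pow₀ (by linarith)
  have p2 : (1 + u) ^ (I.card + 2) ≤ (1 + u) ^ (h + 2) :=
    pow_le_pow_right₀ (by linarith) (by omega)
  have p3 : (1 + u) ^ (I.card + 1) ≤ (1 + u) ^ (I.card + 2) :=
    pow_le_pow_right₀ (by linarith) (by omega)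
  have hg := hu.pow_le
  set Z := ∑ i ∈ I, |z i|
  calc |c - (a + ∑ i ∈ I, z i)|
      = |(c - (a + ∑ i ∈ I, q i)) + (∑ i ∈ I, q i - ∑ i ∈ I, z i)| := by ring_nf
    _ ≤ ((1 + u) ^ (I.card + 1) - 1) * (|a| + (1 + u) * Z) + u * Z := by
        refine (abs_add_le _ _).trans (add_le_add (h1.trans ?_) h3)
        gcongr
    _ = ((1 + u) ^ (I.card + 1) - 1) * |a| + ((1 + u) ^ (I.card + 2) - 1) * Z := by ring
    _ ≤ g * |a| + g * Z := by gcongr <;> linarith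
    _ = _ := by ring

theorem addDot (hu : DotBound u g h) {ι : Type} {I : Finset ι} (hI : I.card ≤ h) {a c : ℝ}
    {x y : ι → ℝ} (hc : FlAddDot u a I x y c) :
    |c - (a + ∑ i ∈ I, x i * y i)| ≤ g * (|a| + ∑ i ∈ I, |x i| * |y i|) := by
  obtain ⟨q, hq, hc⟩ := hc
  simpa [abs_mul] using hu.sum_aux I hI a c _ q hq hc

theorem subDot (hu : DotBound u g h) {ι : Type} {I : Finset ι} (hI : I.card ≤ h) {a c : ℝ}
    {x y : ι → ℝ} (hc : FlSubDot u a I x y c) :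
    |c - (a - ∑ i ∈ I, x i * y i)| ≤ g * (|a| + ∑ i ∈ I, |x i| * |y i|) := by
  obtain ⟨q, hq, hc⟩ := hc
  have := hu.sum_aux I hI a c (fun i => -(x i * y i)) (fun i => -q i) (fun i hi => by
    obtain ⟨δ, h1, h2⟩ := hq i hi
    exact ⟨δ, h1, by rw [h2]; ring⟩) hc
  simpa [abs_mul, sub_eq_add_neg] using this

theorem dot (hu : DotBound u g h) {ι : Type} {I : Finset ι} (hI : I.card ≤ h) {c : ℝ}
    {x y : ι → ℝ} (hc : FlDot u I x y c) :
    |c - ∑ i ∈ I, x i * y i| ≤ g * ∑ i ∈ I, |x i| * |y i| := by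
  obtain ⟨q, hq, hc⟩ := hc
  rcases I.eq_empty_or_nonempty with rfl | hne
  · have h1 := hc.abs_sub_le hu.nonneg
    simpa using h1
  -- Adding a leading zero is exact (`δ = 0`), which reduces the plain inner product to the case
  -- with a summand `a`. Both operands of `FlSum.add` must be nonempty, hence the case split.
  · have h0 : FlSum u (0 ::ₘ I.val.map q) c := by
      have := FlSum.add (u := u) (s := {0}) (t := I.val.map q) (a := 0) (b := c) (c := c)
        (by simp) (by simpa [Finset.nonempty_iff_ne_empty] using hne)
        (FlSum.single 0) hc ⟨0, by simpa using hu.nonneg, by ring⟩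
      simpa using this
    simpa [abs_mul] using hu.sum_aux I hI 0 c _ q hq h0

end DotBound

/-! ### Cholesky factorization -/

/-- Completing the square with the first `l` rows of an approximate Cholesky factor. -/
theorem sum_sq_le_of_partial_cholesky {s : ℕ} {R H : Matrix (Fin s) (Fin s) ℝ} {lam e : ℝ}
    (he : 0 ≤ e) (hse : s * e ≤ lam / 2)
    (hH : ∀ a b, H a b = H b a)
    (hpos : ∀ y : Fin s → ℝ, lam * ∑ a, y a ^ 2 ≤ ∑ a, ∑ b, y a * H a b * y b)
    (hR : ∀ i j, j < i → R i j = 0) (j : Fin s) (l : ℕ) (hl : l ≤ j)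
    (hd : ∀ i : Fin s, i < l → R i i ≠ 0)
    (hE : ∀ a b : Fin s, a ≤ b → a < l → (b < l ∨ b = j) → |∑ i, R i a * R i b - H a b| ≤ e) :
    ∑ i : Fin s, (if i < l then R i j ^ 2 else 0) + lam / 2 ≤ H j j := by
  classical
  -- the solution of the triangular system
  obtain ⟨z, hz1, hz2⟩ : ∃ z : Fin s → ℝ, (∀ a : Fin s, ¬ a < l → z a = 0) ∧
      ∀ i : Fin s, i < l → ∑ a, R i a * z a = R i j := by
    -- The first `l` rows of `R`, completed by rows of the identity: upper triangular with nonzero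
    -- diagonal. The identity rows force `z` to vanish from index `l` on.
    let K : Matrix (Fin s) (Fin s) ℝ :=
      fun i a => if i < l then R i a else if i = a then 1 else 0
    have hK : K.BlockTriangular id := by
      intro i a (hia : a < i)
      have := hR i a hia
      simp only [K]; split_ifs <;> grind
    have hdet : K.det ≠ 0 := by
      rw [Matrix.det_of_isUpperTriangular hK]
      refine Finset.prod_ne_zero_iff.2 fun i _ => ?_
      simp only [K]; split_ifs with h
      · exact hd i h
      · exact one_ne_zero
    have hKu : IsUnit K.det := isUnit_iff_ne_zero.2 hdet
    let r : Fin s → ℝ := fun i => if i < l then R i j else 0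
    have hz : K *ᵥ (K⁻¹ *ᵥ r) = r := by
      rw [Matrix.mulVec_mulVec, Matrix.mul_nonsing_inv _ hKu, Matrix.one_mulVec]
    refine ⟨K⁻¹ *ᵥ r, fun a ha => ?_, fun i hi => ?_⟩
    · have := congrFun hz a
      simpa [Matrix.mulVec, dotProduct, K, r, ha] using this
    · have := congrFun hz i
      simpa [Matrix.mulVec, dotProduct, K, r, hi] using this
  let y : Fin s → ℝ := fun a => (if a = j then 1 else 0) - z a
  have hyj : y j = 1 := by simp [y, hz1 j (by omega)]
  have hRy : ∀ i : Fin s, i < l → ∑ a, R i a * y a = 0 := by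
    intro i hi
    simp [y, mul_sub, Finset.sum_sub_distrib, hz2 i hi]
  have hy0 : ∀ a : Fin s, ¬ a < l → a ≠ j → y a = 0 := by
    intro a ha haj; simp [y, haj, hz1 a ha]
  let G : Matrix (Fin s) (Fin s) ℝ := fun a b => ∑ i : Fin s, if i < l then R i a * R i b else 0
  have hG : ∑ a, ∑ b, y a * G a b * y b = 0 := by
    have : ∀ a, ∑ b, y a * G a b * y b = 0 := by
      intro a
      have h1 : ∀ b, y a * G a b * y b =
          ∑ i : Fin s, y a * (if i < l then R i a * (R i b * y b) else 0) := by
        intro b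
        simp only [G, Finset.mul_sum, Finset.sum_mul]
        refine Finset.sum_congr rfl fun i _ => ?_
        split_ifs <;> ring
      simp_rw [h1]
      rw [Finset.sum_comm]
      refine Finset.sum_eq_zero fun i _ => ?_
      rw [← Finset.mul_sum]
      split_ifs with hi
      · rw [← Finset.mul_sum, hRy i hi]; ring
      · simp
    simp [this]
  have hGs : ∀ a b, G a b = G b a := by intro a b; simp [G, mul_comm]
  have hGR : ∀ a b : Fin s, a < l → G a b = ∑ i, R i a * R i b := by
    intro a b ha
    refine Finset.sum_congr rfl fun i _ => ?_
    split_ifs with hi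
    · rfl
    · rw [hR i a (by omega)]; ring
  have hE' : ∀ a b : Fin s, (a < l ∨ a = j) → (b < l ∨ b = j) → ¬ (a = j ∧ b = j) →
      |G a b - H a b| ≤ e := by
    intro a b ha hb hab
    rcases le_total a b with hle | hle
    · have : a < l := by rcases ha with h | h <;> grind
      rw [hGR a b this]; exact hE a b hle this hb
    · have : b < l := by rcases hb with h | h <;> grind
      rw [hGs, hH, hGR b a this]; exact hE b a hle this ha
  -- The entry `(j, j)` is exempt from the comparison of `H` with `G`: there `H j j - G j j` is the
  -- quantity to be bounded below. Summation over `a, b` leaves it against `lam ‖y‖²` minus an error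
  -- of at most `lam/2 ‖y‖²`, and `‖y‖ ≥ 1`.
  have key : ∀ a b, y a * H a b * y b ≤ y a * G a b * y b + e * (|y a| * |y b|)
      + (if a = j then if b = j then H j j - G j j else 0 else 0) := by
    intro a b
    by_cases hab : a = j ∧ b = j
    · obtain ⟨rfl, rfl⟩ := hab
      simp [hyj]; linarith
    have h0 : (if a = j then if b = j then H j j - G j j else 0 else 0) = 0 := by
      split_ifs <;> grind
    rw [h0, add_zero]
    by_cases ha : a < l ∨ a = j
    · by_cases hb : b < l ∨ b = j
      · have h1 := hE' a b ha hb hab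
        have h2 : |y a * (G a b - H a b) * y b| ≤ e * (|y a| * |y b|) := by
          rw [abs_mul, abs_mul]
          calc |y a| * |G a b - H a b| * |y b| ≤ |y a| * e * |y b| := by gcongr
            _ = _ := by ring
        have h3 := neg_le_of_abs_le h2
        linarith [show y a * (G a b - H a b) * y b = y a * G a b * y b - y a * H a b * y b by ring]
      · push Not at hb
        rw [hy0 b (by omega) hb.2]; simp
    · push Not at ha
      rw [hy0 a (by omega) ha.2]; simp
  have hsum := (hpos y).trans (Finset.sum_le_sum fun a _ => Finset.sum_le_sum fun b _ => key a b)
  simp only [Finset.sum_add_distrib, hG] at hsum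
  have h5 : ∑ a, ∑ b, e * (|y a| * |y b|) = e * (∑ a, |y a|) ^ 2 := by
    rw [sq, Finset.sum_mul_sum]; simp [Finset.mul_sum]
  have h6 : (∑ a, |y a|) ^ 2 ≤ s * ∑ a, y a ^ 2 := by
    have := sq_sum_le_card_mul_sum_sq (s := (Finset.univ : Finset (Fin s))) (f := fun a => |y a|)
    simpa using this
  have h7 : 1 ≤ ∑ a, y a ^ 2 := by
    have := Finset.single_le_sum (f := fun a => y a ^ 2) (fun a _ => sq_nonneg _)
      (Finset.mem_univ j)
    simpa [hyj] using this
  have h8 : ∑ i : Fin s, (if i < l then R i j ^ 2 else 0) = G j j := by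
    simp only [G, sq]
  rw [h5] at hsum
  simp at hsum
  rw [h8]
  have hlam : 0 ≤ lam := by nlinarith [show (0:ℝ) ≤ s * e by positivity]
  have h9 : e * (∑ a, |y a|) ^ 2 ≤ lam / 2 * ∑ a, y a ^ 2 := by
    calc _ ≤ e * (s * ∑ a, y a ^ 2) := by gcongr
      _ = (s * e) * ∑ a, y a ^ 2 := by ring
      _ ≤ _ := by gcongr
  nlinarith

theorem sum_abs_mul_abs_le {ι : Type} (I : Finset ι) (x y : ι → ℝ) {c : ℝ}
    (hx : ∑ i ∈ I, x i ^ 2 ≤ c) (hy : ∑ i ∈ I, y i ^ 2 ≤ c) : ∑ i ∈ I, |x i| * |y i| ≤ c := by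
  have : ∑ i ∈ I, |x i| * |y i| ≤ ∑ i ∈ I, (x i ^ 2 + y i ^ 2) / 2 := by
    refine Finset.sum_le_sum fun i _ => ?_
    nlinarith [sq_nonneg (|x i| - |y i|), sq_abs (x i), sq_abs (y i)]
  rw [← Finset.sum_div, Finset.sum_add_distrib] at this
  linarith

/-- Rounding errors are controlled by the size of the computed entries, which is controlled by the
accuracy of the entries before them; hence the induction over columns. The constant `20` covers `4 +
5` (inner product and division) off the diagonal and `3 + 15` (pivot and square root) on it. -/
theorem FlChol.bound {s h : ℕ} {u g : ℝ} (hu : DotBound u g h) (hs : s ≤ h) (hg : g ≤ 1 / 100)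
    {A R H : Matrix (Fin s) (Fin s) ℝ} {d : Fin s → ℝ} (hc : FlChol u A R d)
    {M lam gA : ℝ} (hlam : 0 < lam) (hgA : 0 ≤ gA) (hM : ∀ a b, |H a b| ≤ M)
    (hA : ∀ a b, a ≤ b → |A a b - H a b| ≤ gA)
    (hse : s * (gA + 20 * g * M) ≤ lam / 4)
    (hH : ∀ a b, H a b = H b a)
    (hpos : ∀ y : Fin s → ℝ, lam * ∑ a, y a ^ 2 ≤ ∑ a, ∑ b, y a * H a b * y b) (j : Fin s) :
    0 < d j ∧ R j j ≠ 0 ∧ (∀ i ≤ j, |∑ l, R l i * R l j - H i j| ≤ gA + 20 * g * M) ∧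
      ∑ l, R l j ^ 2 ≤ 2 * M := by
  induction j using WellFoundedLT.induction with
  | ind j ih =>
  have hg0 := hu.nonneg'
  have hu0 := hu.nonneg
  have hug := hu.le
  have hM0 : 0 ≤ M := (abs_nonneg _).trans (hM j j)
  set e := gA + 20 * g * M with he
  have he0 : 0 ≤ e := by positivity
  have hs1 : (1 : ℝ) ≤ s := by exact_mod_cast j.pos
  have hes : e ≤ lam / 4 := by nlinarith
  have hse' : s * e ≤ lam / 2 := by linarith
  have hR := hc.lower
  have hHM := fun a b => abs_le.1 (hM a b)
  have hlamM : lam ≤ M := by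
    have := hpos (Pi.single j 1)
    have e1 : ∑ a, (Pi.single j (1 : ℝ) : Fin s → ℝ) a ^ 2 = 1 := by
      simp [Pi.single_apply]
    have e2 : ∑ a, ∑ b, (Pi.single j (1 : ℝ) : Fin s → ℝ) a * H a b *
        (Pi.single j (1 : ℝ) : Fin s → ℝ) b = H j j := by
      simp [Pi.single_apply]
    rw [e1, e2] at this
    linarith [(hHM j j).2]
  have hgM : 0 ≤ g * M := by positivity
  have hgAM : gA ≤ M := by linarith
  have hsplit : ∀ (i : Fin s) (f : Fin s → ℝ), (∀ l, i < l → f l = 0) →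
      ∑ l, f l = ∑ l ∈ Finset.Iio i, f l + f i := by
    intro i f hf
    rw [← Finset.sum_subset (Finset.subset_univ (Finset.Iic i)), ← Finset.Iio_insert,
      Finset.sum_insert (by simp), add_comm]
    intro x _ hx
    exact hf x (by simpa using hx)
  have hdiagne : ∀ i, i < j → R i i ≠ 0 := fun i hi => (ih i hi).2.1
  have hcol : ∀ i : Fin s, i ≤ j → (∑ i' : Fin s, (if (i' : ℕ) < i then R i' j ^ 2 else 0)) ≤ M →
      ∑ l ∈ Finset.Iio i, R l j ^ 2 ≤ 2 * M := by
    intro i _ hi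
    rw [← Finset.sum_filter] at hi
    have : Finset.univ.filter (fun i' : Fin s => (i' : ℕ) < i) = Finset.Iio i := by
      ext x; simp
    rw [this] at hi; linarith
  have hcard : ∀ i : Fin s, (Finset.Iio i).card ≤ h := fun i => by
    rw [Fin.card_Iio]; omega
  have hoff : ∀ i : Fin s, i < j →
      (∑ i' : Fin s, (if (i' : ℕ) < i then R i' j ^ 2 else 0)) ≤ M →
      |∑ l, R l i * R l j - H i j| ≤ e := by
    intro i hij hi
    obtain ⟨t, ht, hr⟩ := hc.off i j hij
    have hdot := hu.subDot (hcard i) ht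
    have h1 : ∑ l ∈ Finset.Iio i, R l i ^ 2 ≤ 2 * M := by
      refine le_trans ?_ (ih i hij).2.2.2
      exact Finset.sum_le_sum_of_subset_of_nonneg (Finset.subset_univ _)
        fun _ _ _ => sq_nonneg _
    have h2 := sum_abs_mul_abs_le _ _ _ h1 (hcol i hij.le hi)
    have h3 : |∑ l ∈ Finset.Iio i, R l i * R l j| ≤ 2 * M :=
      (Finset.abs_sum_le_sum_abs _ _).trans (by simpa [abs_mul] using h2)
    have h4 := abs_le.1 (hA i j hij.le)
    have h6 : |A i j| ≤ 2 * M := by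
      have := hHM i j
      rw [abs_le]; constructor <;> linarith
    have h7 : |t - (A i j - ∑ l ∈ Finset.Iio i, R l i * R l j)| ≤ 4 * g * M := by
      refine hdot.trans ?_
      calc g * (|A i j| + ∑ l ∈ Finset.Iio i, |R l i| * |R l j|) ≤ g * (2 * M + 2 * M) := by gcongr
        _ = _ := by ring
    have h8 : |t| ≤ 5 * M := by
      have e1 := abs_le.1 h7
      have e2 := abs_le.1 h6
      have e3 := abs_le.1 h3
      have e4 : g * M ≤ 1 / 100 * M := by gcongr
      rw [abs_le]; constructor <;> linarith
    have h9 : |R i i * R i j - t| ≤ g * (5 * M) := by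
      obtain ⟨δ, hδ, hx⟩ := hr
      have := hdiagne i hij
      rw [hx, show R i i * (t / R i i * (1 + δ)) - t = δ * t by field_simp; ring, abs_mul]
      gcongr
      exact hδ.trans hug
    rw [hsplit i _ (fun l hl => by rw [hR l i hl, zero_mul])]
    have e1 := abs_le.1 h7
    have e2 := abs_le.1 h9
    have e5 : 0 ≤ g * M := by positivity
    rw [abs_le, he]; constructor <;> linarith
  -- Inner induction down column `j`: accuracy of the entries above row `l` bounds their sum of
  -- squares, and this bound makes the next entry accurate. At `l = j` the margin `lam / 2` keeps
  -- the pivot positive.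
  have hinner : ∀ l : ℕ, l ≤ j →
      (∑ i : Fin s, (if (i : ℕ) < l then R i j ^ 2 else 0)) + lam / 2 ≤ H j j := by
    intro l
    induction l using Nat.strong_induction_on with
    | _ l ihl =>
    intro hl
    refine sum_sq_le_of_partial_cholesky he0 hse' hH hpos hR j l hl
      (fun i hi => hdiagne i (by omega)) ?_
    intro a b hab ha hb
    rcases hb with hb | rfl
    · exact (ih b (by omega)).2.2.1 a hab
    · exact hoff a (by omega) (by linarith [ihl a ha (by omega), (hHM b b).2])
  have hj := hinner j le_rfl
  have hjM : (∑ i : Fin s, (if (i : ℕ) < j then R i j ^ 2 else 0)) ≤ M := by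
    linarith [(hHM j j).2]
  have hS : ∑ l ∈ Finset.Iio j, R l j ^ 2 =
      ∑ i : Fin s, (if (i : ℕ) < j then R i j ^ 2 else 0) := by
    rw [← Finset.sum_filter]
    congr 1
    ext x; simp
  rw [← hS] at hj hjM
  set S := ∑ l ∈ Finset.Iio j, R l j ^ 2
  have hS0 : 0 ≤ S := Finset.sum_nonneg fun _ _ => sq_nonneg _
  have hAj := abs_le.1 (hA j j le_rfl)
  have hHj := hHM j j
  have hdj := hu.subDot (hcard j) (hc.pivot j)
  have hdj' : |d j - (A j j - S)| ≤ g * (3 * M) := by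
    have e1 : ∑ l ∈ Finset.Iio j, R l j * R l j = S := by simp [S, sq]
    have e2 : ∑ l ∈ Finset.Iio j, |R l j| * |R l j| = S := by simp [S, sq]
    rw [e1, e2] at hdj
    refine hdj.trans ?_
    gcongr
    have : |A j j| ≤ 2 * M := by rw [abs_le]; constructor <;> linarith
    linarith
  have hdj2 := abs_le.1 hdj'
  have hgs : g * M ≤ 1 / 100 * M := by gcongr
  have hdpos : 0 < d j := by linarith
  have hd5 : d j ≤ 5 * M := by linarith
  obtain ⟨δ, hδ, hRj⟩ := hc.diag j
  have hδ' := abs_le.1 (hδ.trans hug)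
  have hδ1 : 0 < 1 + δ := by linarith
  have hRpos : 0 < R j j := by rw [hRj]; exact mul_pos (Real.sqrt_pos.2 hdpos) hδ1
  have hRsq : |R j j ^ 2 - d j| ≤ 15 * (g * M) := by
    rw [hRj, mul_pow, Real.sq_sqrt hdpos.le,
      show d j * (1 + δ) ^ 2 - d j = d j * ((2 + δ) * δ) by ring, abs_mul, abs_mul,
      abs_of_pos hdpos, abs_of_pos (show 0 < 2 + δ by linarith)]
    have h1 : (2 + δ) * |δ| ≤ 3 * g :=
      mul_le_mul (by linarith) (hδ.trans hug) (abs_nonneg _) (by norm_num)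
    calc d j * ((2 + δ) * |δ|) ≤ (5 * M) * (3 * g) :=
          mul_le_mul hd5 h1 (mul_nonneg (by linarith) (abs_nonneg _)) (by positivity)
      _ = _ := by ring
  have hRsq' := abs_le.1 hRsq
  have hfin : ∑ l, R l j ^ 2 = S + R j j ^ 2 :=
    hsplit j _ (fun l hl => by rw [hR l j hl]; ring)
  refine ⟨hdpos, hRpos.ne', fun i hi => ?_, ?_⟩
  · rcases hi.eq_or_lt with rfl | hi
    · have : ∑ l, R l i * R l i = S + R i i ^ 2 := by rw [← hfin]; simp [sq]
      rw [this, abs_le, he]; constructor <;> linarith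
    · exact hoff i hi (by linarith [hinner i (by omega)])
  · rw [hfin]; linarith

/-! ### The matrix 2-norm -/

section Norm

variable {ι κ α β : Type} [Fintype ι] [Fintype κ] [Fintype α] [Fintype β]

/-- The Euclidean norm of a vector. -/
noncomputable def vnorm (y : ι → ℝ) : ℝ := ‖(WithLp.toLp 2 y : EuclideanSpace ℝ ι)‖

theorem vnorm_nonneg (y : ι → ℝ) : 0 ≤ vnorm y := norm_nonneg _

theorem vnorm_sq' (y : ι → ℝ) : vnorm y ^ 2 = ∑ i, y i ^ 2 := by
  simp [vnorm, EuclideanSpace.norm_sq_eq]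

theorem vnorm_sq (y : ι → ℝ) : vnorm y ^ 2 = y ⬝ᵥ y := by
  rw [vnorm_sq']; simp [dotProduct, sq]

theorem vnorm_sub_ge (x y : ι → ℝ) : vnorm x - vnorm y ≤ vnorm (x - y) := by
  simp only [vnorm, WithLp.toLp_sub]; exact norm_sub_norm_le _ _

theorem vnorm_eq_zero {y : ι → ℝ} : vnorm y = 0 ↔ y = 0 := by
  simp [vnorm]

theorem abs_dotProduct_le (x y : ι → ℝ) : |x ⬝ᵥ y| ≤ vnorm x * vnorm y := by
  have := abs_real_inner_le_norm (WithLp.toLp 2 y : EuclideanSpace ℝ ι) (WithLp.toLp 2 x)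
  simp [EuclideanSpace.inner_toLp_toLp] at this
  simpa [vnorm, mul_comm] using this

variable [DecidableEq ι] [DecidableEq κ] [DecidableEq α] [DecidableEq β]

theorem vnorm_mulVec_le (A : Matrix ι κ ℝ) (y : κ → ℝ) : vnorm (A *ᵥ y) ≤ ‖A‖ * vnorm y :=
  A.l2_opNorm_mulVec (WithLp.toLp 2 y)

theorem norm_le_of_vnorm {A : Matrix ι κ ℝ} {c : ℝ} (hc : 0 ≤ c)
    (h : ∀ y, vnorm (A *ᵥ y) ≤ c * vnorm y) : ‖A‖ ≤ c := by
  rw [Matrix.l2_opNorm_def]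
  exact ContinuousLinearMap.opNorm_le_bound _ hc fun x => h x.ofLp

theorem norm_mul_le (A : Matrix ι κ ℝ) (B : Matrix κ α ℝ) : ‖A * B‖ ≤ ‖A‖ * ‖B‖ :=
  A.l2_opNorm_mul B

theorem norm_transpose (A : Matrix ι κ ℝ) : ‖Aᵀ‖ = ‖A‖ := by
  rw [← Matrix.conjTranspose_eq_transpose_of_trivial, Matrix.l2_opNorm_conjTranspose]

theorem norm_transpose_mul_self (A : Matrix ι κ ℝ) : ‖Aᵀ * A‖ = ‖A‖ ^ 2 := by
  rw [← Matrix.conjTranspose_eq_transpose_of_trivial, Matrix.l2_opNorm_conjTranspose_mul_self, sq]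

theorem norm_one_le : ‖(1 : Matrix ι ι ℝ)‖ ≤ 1 :=
  norm_le_of_vnorm zero_le_one fun y => by simp

theorem abs_entry_le (A : Matrix ι κ ℝ) (i : ι) (j : κ) : |A i j| ≤ ‖A‖ := by
  have h1 := vnorm_mulVec_le A (Pi.single j 1)
  have h2 : vnorm (Pi.single j (1 : ℝ) : κ → ℝ) = 1 := by
    have := vnorm_sq' (Pi.single j (1 : ℝ) : κ → ℝ)
    rw [← sq_eq_sq₀ (vnorm_nonneg _) zero_le_one, this]
    simp [Pi.single_apply]
  rw [h2, mul_one] at h1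
  refine le_trans ?_ h1
  rw [← sq_le_sq₀ (abs_nonneg _) (vnorm_nonneg _), vnorm_sq', sq_abs]
  refine le_trans ?_ (Finset.single_le_sum (fun _ _ => sq_nonneg _) (Finset.mem_univ i))
  simp

theorem norm_le_of_entry {A : Matrix ι κ ℝ} {c : ℝ} (hc : 0 ≤ c) (h : ∀ i j, |A i j| ≤ c) {d : ℕ}
    (hι : Fintype.card ι ≤ d) (hκ : Fintype.card κ ≤ d) : ‖A‖ ≤ d * c := by
  have hι' : (Fintype.card ι : ℝ) ≤ d := by exact_mod_cast hι
  have hκ' : (Fintype.card κ : ℝ) ≤ d := by exact_mod_cast hκ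
  refine norm_le_of_vnorm (by positivity) fun y => ?_
  rw [← sq_le_sq₀ (vnorm_nonneg _) (mul_nonneg (by positivity) (vnorm_nonneg _)), vnorm_sq',
    mul_pow, vnorm_sq']
  have h1 : ∀ i, (A *ᵥ y) i ^ 2 ≤ d * c ^ 2 * ∑ j, y j ^ 2 := by
    intro i
    calc (A *ᵥ y) i ^ 2 ≤ (∑ j, A i j ^ 2) * ∑ j, y j ^ 2 :=
          Finset.sum_mul_sq_le_sq_mul_sq _ _ _
      _ ≤ (∑ _j : κ, c ^ 2) * ∑ j, y j ^ 2 := by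
          gcongr ?_ * _
          refine Finset.sum_le_sum fun j _ => ?_
          rw [← sq_abs]; gcongr; exact h i j
      _ ≤ _ := by
          rw [Finset.sum_const, Finset.card_univ, nsmul_eq_mul]; gcongr
  calc ∑ i, (A *ᵥ y) i ^ 2 ≤ ∑ _i : ι, d * c ^ 2 * ∑ j, y j ^ 2 :=
        Finset.sum_le_sum fun i _ => h1 i
    _ = Fintype.card ι * (d * c ^ 2 * ∑ j, y j ^ 2) := by simp
    _ ≤ d * (d * c ^ 2 * ∑ j, y j ^ 2) := by gcongr
    _ = _ := by ring

/-! #### Submatrices and blocks -/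

theorem norm_one_submatrix_le {f : α → ι} (hf : f.Injective) :
    ‖(1 : Matrix ι ι ℝ).submatrix id f‖ ≤ 1 := by
  have : ((1 : Matrix ι ι ℝ).submatrix id f)ᵀ * (1 : Matrix ι ι ℝ).submatrix id f = 1 := by
    ext a b
    simp [Matrix.mul_apply, Matrix.one_apply, hf.eq_iff]
  have h1 := norm_transpose_mul_self ((1 : Matrix ι ι ℝ).submatrix id f)
  rw [this] at h1
  have := norm_one_le (ι := α)
  nlinarith [norm_nonneg ((1 : Matrix ι ι ℝ).submatrix id f)]

theorem norm_submatrix_cols_le (A : Matrix ι κ ℝ) {f : α → κ} (hf : f.Injective) :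
    ‖A.submatrix id f‖ ≤ ‖A‖ := by
  have : A.submatrix id f = A * (1 : Matrix κ κ ℝ).submatrix id f := by
    ext i j; simp [Matrix.mul_apply, Matrix.one_apply]
  rw [this]
  refine (norm_mul_le _ _).trans ?_
  exact mul_le_of_le_one_right (norm_nonneg _) (norm_one_submatrix_le hf)

/-- The maps `f` and `g` partition the columns, and the matrices selecting them have norm at most
one. -/
theorem norm_le_add_cols (A : Matrix ι κ ℝ) {f : α → κ} {g : β → κ}
    (hf : f.Injective) (hg : g.Injective) (hd : ∀ a b, f a ≠ g b)
    (hs : ∀ c, (∃ a, f a = c) ∨ ∃ b, g b = c) :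
    ‖A‖ ≤ ‖A.submatrix id f‖ + ‖A.submatrix id g‖ := by
  have h1 : A = A.submatrix id f * ((1 : Matrix κ κ ℝ).submatrix id f)ᵀ +
      A.submatrix id g * ((1 : Matrix κ κ ℝ).submatrix id g)ᵀ := by
    ext i j
    rcases hs j with ⟨a, rfl⟩ | ⟨b, rfl⟩
    · simp [Matrix.mul_apply, Matrix.one_apply, hf.eq_iff, fun b => (hd a b).symm]
    · simp [Matrix.mul_apply, Matrix.one_apply, hg.eq_iff, fun a => hd a b]
  calc ‖A‖ ≤ ‖A.submatrix id f * ((1 : Matrix κ κ ℝ).submatrix id f)ᵀ‖ +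
        ‖A.submatrix id g * ((1 : Matrix κ κ ℝ).submatrix id g)ᵀ‖ := by
        conv_lhs => rw [h1]
        exact norm_add_le _ _
    _ ≤ _ := by
        refine add_le_add ((norm_mul_le _ _).trans ?_) ((norm_mul_le _ _).trans ?_) <;>
          rw [norm_transpose]
        · exact mul_le_of_le_one_right (norm_nonneg _) (norm_one_submatrix_le hf)
        · exact mul_le_of_le_one_right (norm_nonneg _) (norm_one_submatrix_le hg)

theorem norm_le_add_rows (A : Matrix κ ι ℝ) {f : α → κ} {g : β → κ}
    (hf : f.Injective) (hg : g.Injective) (hd : ∀ a b, f a ≠ g b)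
    (hs : ∀ c, (∃ a, f a = c) ∨ ∃ b, g b = c) :
    ‖A‖ ≤ ‖A.submatrix f id‖ + ‖A.submatrix g id‖ := by
  have := norm_le_add_cols Aᵀ hf hg hd hs
  rw [← norm_transpose A, ← norm_transpose (A.submatrix f id), ← norm_transpose (A.submatrix g id)]
  exact this

/-- The Gram matrix of a matrix whose columns are split into two parts. -/
theorem norm_one_sub_gram_le (A : Matrix ι κ ℝ) {f : α → κ} {g : β → κ}
    (hf : f.Injective) (hg : g.Injective) (hd : ∀ a b, f a ≠ g b)
    (hs : ∀ c, (∃ a, f a = c) ∨ ∃ b, g b = c) :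
    ‖1 - Aᵀ * A‖ ≤ ‖1 - (A.submatrix id f)ᵀ * A.submatrix id f‖ +
      ‖1 - (A.submatrix id g)ᵀ * A.submatrix id g‖ +
      2 * ‖(A.submatrix id f)ᵀ * A.submatrix id g‖ := by
  set M := 1 - Aᵀ * A
  have h1 := norm_le_add_cols M hf hg hd hs
  have h2 := norm_le_add_rows (M.submatrix id f) hf hg hd hs
  have h3 := norm_le_add_rows (M.submatrix id g) hf hg hd hs
  have e1 : (M.submatrix id f).submatrix f id =
      1 - (A.submatrix id f)ᵀ * A.submatrix id f := by
    ext a b; simp [M, Matrix.mul_apply, Matrix.one_apply, hf.eq_iff]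
  have e2 : (M.submatrix id g).submatrix g id =
      1 - (A.submatrix id g)ᵀ * A.submatrix id g := by
    ext a b; simp [M, Matrix.mul_apply, Matrix.one_apply, hg.eq_iff]
  have e3 : (M.submatrix id g).submatrix f id = -((A.submatrix id f)ᵀ * A.submatrix id g) := by
    ext a b; simp [M, Matrix.mul_apply, hd]
  have e4 : (M.submatrix id f).submatrix g id =
      (-((A.submatrix id f)ᵀ * A.submatrix id g))ᵀ := by
    ext a b; simp [M, Matrix.mul_apply, (hd _ _).symm, mul_comm]
  rw [e1, e4, norm_transpose, norm_neg] at h2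
  rw [e2, e3, norm_neg] at h3
  linarith

/-! #### Lower bounds -/

/-- `c ‖y‖ ≤ ‖A y‖` for all vectors `y`. -/
def LowerBound (c : ℝ) (A : Matrix ι κ ℝ) : Prop := ∀ y, c * vnorm y ≤ vnorm (A *ᵥ y)

theorem LowerBound.mulVec_eq_zero {c : ℝ} (hc : 0 < c) {A : Matrix ι κ ℝ} (h : LowerBound c A)
    {y : κ → ℝ} (hy : A *ᵥ y = 0) : y = 0 := by
  have h1 := h y
  rw [hy, vnorm_eq_zero.2 rfl] at h1
  have h2 := vnorm_nonneg y
  exact vnorm_eq_zero.1 (by nlinarith)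

theorem LowerBound.isUnit_det {c : ℝ} (hc : 0 < c) {A : Matrix ι ι ℝ} (h : LowerBound c A) :
    IsUnit A.det := by
  rw [isUnit_iff_ne_zero, ne_eq, ← Matrix.exists_mulVec_eq_zero_iff]
  rintro ⟨v, hv, hv0⟩
  exact hv (h.mulVec_eq_zero hc hv0)

theorem LowerBound.norm_inv_le {c : ℝ} (hc : 0 < c) {A : Matrix ι ι ℝ} (h : LowerBound c A) :
    ‖A⁻¹‖ ≤ 1 / c := by
  refine norm_le_of_vnorm (by positivity) fun y => ?_
  have := h (A⁻¹ *ᵥ y)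
  rw [Matrix.mulVec_mulVec, Matrix.mul_nonsing_inv _ (h.isUnit_det hc), Matrix.one_mulVec] at this
  rw [div_mul_eq_mul_div, le_div_iff₀ hc]; linarith

theorem LowerBound.mono {c c' : ℝ} (hcc : c' ≤ c) {A : Matrix ι κ ℝ} (h : LowerBound c A) :
    LowerBound c' A := fun y =>
  (mul_le_mul_of_nonneg_right hcc (vnorm_nonneg y)).trans (h y)

theorem LowerBound.sub {c : ℝ} {A B : Matrix ι κ ℝ} (h : LowerBound c A) :
    LowerBound (c - ‖B‖) (A - B) := fun y => by
  rw [Matrix.sub_mulVec]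
  have := vnorm_sub_ge (A *ᵥ y) (B *ᵥ y)
  have := vnorm_mulVec_le B y
  have := h y
  rw [sub_mul]; linarith

theorem dotProduct_gram (A : Matrix ι κ ℝ) (y : κ → ℝ) :
    y ⬝ᵥ ((Aᵀ * A) *ᵥ y) = vnorm (A *ᵥ y) ^ 2 := by
  rw [vnorm_sq, ← Matrix.mulVec_mulVec, Matrix.dotProduct_mulVec, Matrix.vecMul_transpose]

theorem abs_quad_le (A : Matrix ι ι ℝ) (y : ι → ℝ) : |y ⬝ᵥ (A *ᵥ y)| ≤ ‖A‖ * vnorm y ^ 2 := by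
  have h1 := abs_dotProduct_le y (A *ᵥ y)
  have h2 := vnorm_mulVec_le A y
  have h3 := vnorm_nonneg y
  nlinarith

/-- A lower bound for the quadratic form of `H` from one for a nearby Gram matrix. -/
theorem LowerBound.quad {c lam : ℝ} (hc : 0 ≤ c) {A : Matrix ι κ ℝ} (h : LowerBound c A)
    {H : Matrix κ κ ℝ} (hl : lam ≤ c ^ 2 - ‖Aᵀ * A - H‖) (y : κ → ℝ) :
    lam * vnorm y ^ 2 ≤ y ⬝ᵥ (H *ᵥ y) := by
  have h1 := abs_quad_le (Aᵀ * A - H) y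
  rw [Matrix.sub_mulVec, dotProduct_sub, dotProduct_gram] at h1
  have h2 := (abs_le.1 h1).2
  have h3 : c ^ 2 * vnorm y ^ 2 ≤ vnorm (A *ᵥ y) ^ 2 := by
    rw [← mul_pow]
    have := h y
    have := mul_nonneg hc (vnorm_nonneg y)
    gcongr
  nlinarith [sq_nonneg (vnorm y)]

/-- A converse to `LowerBound.quad`. Together they carry a lower bound from the projected block
through `Xᵀ X - Sᵀ S` to the computed Cholesky factor. -/
theorem lowerBound_of_quad {c : ℝ} (hc : 0 ≤ c) {A : Matrix ι κ ℝ} {H : Matrix κ κ ℝ} {lam : ℝ}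
    (h : ∀ y, lam * vnorm y ^ 2 ≤ y ⬝ᵥ (H *ᵥ y)) (hl : c ^ 2 ≤ lam - ‖Aᵀ * A - H‖) :
    LowerBound c A := fun y => by
  have h1 := abs_quad_le (Aᵀ * A - H) y
  rw [Matrix.sub_mulVec, dotProduct_sub, dotProduct_gram] at h1
  have h2 := (abs_le.1 h1).1
  have h3 := h y
  rw [← sq_le_sq₀ (mul_nonneg hc (vnorm_nonneg y)) (vnorm_nonneg _), mul_pow]
  nlinarith [sq_nonneg (vnorm y)]

end Norm

/-! ### The condition number -/

section Cond

variable {n : Type} [Fintype n] [DecidableEq n] {m : ℕ}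

theorem norm_toEuclideanLin (X : Matrix (Fin m) n ℝ) (x : EuclideanSpace ℝ n) :
    ‖Matrix.toEuclideanLin X x‖ = vnorm (X *ᵥ x.ofLp) := rfl

/-- Diagonalization of `Tᵀ T` in an orthonormal eigenbasis; both extreme singular values are read
off from it. -/
theorem sq_vnorm_mulVec_eq_sum (X : Matrix (Fin m) n ℝ) (x : EuclideanSpace ℝ n) :
    let T := Matrix.toEuclideanLin X
    let b := T.isSymmetric_adjoint_comp_self.eigenvectorBasis (finrank_euclideanSpace (𝕜 := ℝ))
    ‖T x‖ ^ 2 = ∑ i : Fin (Fintype.card n), T.singularValues i ^ 2 * (b.repr x i) ^ 2 := by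
  intro T b
  have hn : Module.finrank ℝ (EuclideanSpace ℝ n) = Fintype.card n := finrank_euclideanSpace
  have h1 : ‖T x‖ ^ 2 = inner ℝ ((LinearMap.adjoint T ∘ₗ T) x) x := by
    rw [LinearMap.comp_apply, LinearMap.adjoint_inner_left, real_inner_self_eq_norm_sq]
  rw [h1, ← b.sum_inner_mul_inner]
  refine Finset.sum_congr rfl fun i _ => ?_
  have h2 := T.isSymmetric_adjoint_comp_self.eigenvectorBasis_apply_self_apply hn x i
  rw [T.sq_singularValues_fin hn, real_inner_comm, ← b.repr_apply_apply, ← b.repr_apply_apply]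
  simp only [b]
  rw [h2]
  simp; ring

theorem singularValues_bounds [Nonempty n] (X : Matrix (Fin m) n ℝ) :
    (Matrix.toEuclideanLin X).singularValues 0 = ‖X‖ ∧
    LowerBound ((Matrix.toEuclideanLin X).singularValues (Fintype.card n - 1)) X ∧
    ∃ y : n → ℝ, vnorm y = 1 ∧
      vnorm (X *ᵥ y) = (Matrix.toEuclideanLin X).singularValues (Fintype.card n - 1) := by
  set T := Matrix.toEuclideanLin X with hT
  let b := T.isSymmetric_adjoint_comp_self.eigenvectorBasis (finrank_euclideanSpace (𝕜 := ℝ))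
  have hcard : 0 < Fintype.card n := Fintype.card_pos
  have hsum : ∀ x : EuclideanSpace ℝ n,
      ‖T x‖ ^ 2 = ∑ i : Fin (Fintype.card n), T.singularValues i ^ 2 * (b.repr x i) ^ 2 := sq_vnorm_mulVec_eq_sum X
  have hx : ∀ x : EuclideanSpace ℝ n, ‖x‖ ^ 2 = ∑ i, (b.repr x i) ^ 2 := by
    intro x
    rw [← b.repr.norm_map, EuclideanSpace.norm_sq_eq]; simp
  have hb : ∀ i, ‖T (b i)‖ = T.singularValues i := by
    intro i
    rw [← sq_eq_sq₀ (norm_nonneg _) (T.singularValues_nonneg _), hsum]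
    simp [PiLp.single_apply]
  have hnn := T.singularValues_nonneg
  have hub : ‖X‖ ≤ T.singularValues 0 := by
    refine norm_le_of_vnorm (hnn 0) fun y => ?_
    have h1 := hsum (WithLp.toLp 2 y)
    have h2 := hx (WithLp.toLp 2 y)
    rw [← sq_le_sq₀ (vnorm_nonneg _) (mul_nonneg (hnn 0) (vnorm_nonneg y)), mul_pow]
    change ‖T (WithLp.toLp 2 y)‖ ^ 2 ≤ T.singularValues 0 ^ 2 * ‖WithLp.toLp 2 y‖ ^ 2
    rw [h1, h2, Finset.mul_sum]
    refine Finset.sum_le_sum fun i _ => ?_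
    have := T.singularValues_antitone (Nat.zero_le i)
    have := hnn i
    gcongr
  refine ⟨le_antisymm ?_ hub, fun y => ?_, ?_⟩
  · have h1 := vnorm_mulVec_le X (b ⟨0, hcard⟩).ofLp
    have h2 : vnorm (b ⟨0, hcard⟩).ofLp = 1 := b.norm_eq_one _
    rw [h2, mul_one] at h1
    rwa [← norm_toEuclideanLin, ← hT, hb] at h1
  · have h1 := hsum (WithLp.toLp 2 y)
    have h2 := hx (WithLp.toLp 2 y)
    rw [← sq_le_sq₀ (mul_nonneg (hnn _) (vnorm_nonneg y)) (vnorm_nonneg _), mul_pow]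
    change T.singularValues _ ^ 2 * ‖WithLp.toLp 2 y‖ ^ 2 ≤ ‖T (WithLp.toLp 2 y)‖ ^ 2
    rw [h1, h2, Finset.mul_sum]
    refine Finset.sum_le_sum fun i _ => ?_
    have := T.singularValues_antitone (show (i : ℕ) ≤ Fintype.card n - 1 by omega)
    have := hnn (Fintype.card n - 1)
    gcongr
  · exact ⟨(b ⟨Fintype.card n - 1, by omega⟩).ofLp, b.norm_eq_one _, hb _⟩

theorem HasFullColumnRank.mulVec_injective {X : Matrix (Fin m) n ℝ} (hX : HasFullColumnRank X) :
    Function.Injective X.mulVec :=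
  Matrix.mulVec_injective_iff.2 hX

/-- The smallest singular value of a matrix of full column rank. -/
theorem HasFullColumnRank.exists_cond_eq [Nonempty n] {X : Matrix (Fin m) n ℝ}
    (hX : HasFullColumnRank X) :
    ∃ σ : ℝ, 0 < σ ∧ σ ≤ ‖X‖ ∧ LowerBound σ X ∧ cond X = ‖X‖ / σ ∧
      ∃ y : n → ℝ, vnorm y = 1 ∧ vnorm (X *ᵥ y) = σ := by
  obtain ⟨h1, h2, y, hy, hy'⟩ := singularValues_bounds X
  have hpos : 0 < (Matrix.toEuclideanLin X).singularValues (Fintype.card n - 1) := by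
    refine lt_of_le_of_ne (LinearMap.singularValues_nonneg _ _) fun h0 => ?_
    rw [← h0, vnorm_eq_zero] at hy'
    have : y = 0 := hX.mulVec_injective (by simpa using hy')
    rw [this, vnorm_eq_zero.2 rfl] at hy
    exact zero_ne_one hy
  refine ⟨_, hpos, ?_, h2, by rw [cond, h1], y, hy, hy'⟩
  rw [← h1]
  exact LinearMap.singularValues_antitone _ (Nat.zero_le _)

theorem exists_mulVec_eq_submatrix_mulVec {α : Type} [Fintype α] [DecidableEq α] (X : Matrix (Fin m) n ℝ)
    {f : α → n} (hf : f.Injective) (y : α → ℝ) :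
    ∃ z : n → ℝ, vnorm z = vnorm y ∧ X *ᵥ z = X.submatrix id f *ᵥ y := by
  refine ⟨Function.extend f y 0, ?_, ?_⟩
  · rw [← sq_eq_sq₀ (vnorm_nonneg _) (vnorm_nonneg _), vnorm_sq', vnorm_sq']
    refine (Fintype.sum_of_injective f hf _ _ (fun i hi => ?_) fun i => ?_).symm
    · rw [Function.extend_apply' _ _ _ (by simpa using hi)]; simp
    · rw [hf.extend_apply]
  · ext r
    refine (Fintype.sum_of_injective f hf _ _ (fun i hi => ?_) fun i => ?_).symm
    · rw [Function.extend_apply' _ _ _ (by simpa using hi)]; simp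
    · rw [hf.extend_apply]; rfl

theorem LowerBound.submatrix {α : Type} [Fintype α] [DecidableEq α] {X : Matrix (Fin m) n ℝ}
    {c : ℝ} (h : LowerBound c X) {f : α → n} (hf : f.Injective) :
    LowerBound c (X.submatrix id f) := fun y => by
  obtain ⟨z, hz1, hz2⟩ := exists_mulVec_eq_submatrix_mulVec X hf y
  rw [← hz1, ← hz2]; exact h z

theorem HasFullColumnRank.submatrix {α : Type} {X : Matrix (Fin m) n ℝ} (hX : HasFullColumnRank X)
    {f : α → n} (hf : f.Injective) : HasFullColumnRank (X.submatrix id f) :=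
  LinearIndependent.comp hX f hf

/-- Extending a vector by zero shows that the smallest singular value cannot decrease when columns
are dropped. Used for the first block, so that the assumption on the routine applies, and for the
leading blocks in the final bound. -/
theorem cond_submatrix_le {α : Type} [Fintype α] [DecidableEq α] [Nonempty α]
    {X : Matrix (Fin m) n ℝ} (hX : HasFullColumnRank X) {f : α → n} (hf : f.Injective) :
    0 ≤ cond (X.submatrix id f) ∧ cond (X.submatrix id f) ≤ cond X := by
  have : Nonempty n := ⟨f (Classical.arbitrary α)⟩
  obtain ⟨σ, h1, -, h2, h3, -⟩ := hX.exists_cond_eq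
  obtain ⟨τ, k1, -, -, k3, y, hy, hy'⟩ := (hX.submatrix hf).exists_cond_eq
  have h4 := h2.submatrix hf y
  rw [hy, hy', mul_one] at h4
  rw [h3, k3]
  exact ⟨by positivity, div_le_div₀ (norm_nonneg _) (norm_submatrix_cols_le X hf) h1 h4⟩

end Cond

/-! ### One Pythagorean inner product projection in floating-point arithmetic -/

/-- The projection of `X` against `Q` with a Pythagorean Cholesky factor, in two precisions:
`S = Qᵀ X`, `G = chol (Xᵀ X - Sᵀ S)`, `V = X - Q S`, `U = V G⁻¹`. -/
structure FlPIP {m s : ℕ} {ι : Type} [Fintype ι] (εl εh : ℝ) (Q : Matrix (Fin m) ι ℝ)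
    (X V U : Matrix (Fin m) (Fin s) ℝ) (S : Matrix ι (Fin s) ℝ)
    (G Ω A : Matrix (Fin s) (Fin s) ℝ) (d : Fin s → ℝ) : Prop where
  S_eq : ∀ i b, FlDot εl Finset.univ (fun r => Q r i) (fun r => X r b) (S i b)
  Ω_eq : ∀ a b, FlDot εh Finset.univ (fun r => X r a) (fun r => X r b) (Ω a b)
  A_eq : ∀ a b, FlSubDot εh (Ω a b) Finset.univ (fun i => S i a) (fun i => S i b) (A a b)
  chol : FlChol εh A G d
  V_eq : ∀ r b, FlSubDot εl (X r b) Finset.univ (fun i => Q r i) (fun i => S i b) (V r b)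
  U_eq : FlRightSolve εl εh V G U

theorem sum_abs_mul_abs_le_card {ι : Type} {I : Finset ι} {h : ℕ} (hI : I.card ≤ h) {x y : ι → ℝ}
    {a b : ℝ} (ha : 0 ≤ a) (hb : 0 ≤ b) (hx : ∀ i, |x i| ≤ a) (hy : ∀ i, |y i| ≤ b) :
    ∑ i ∈ I, |x i| * |y i| ≤ h * (a * b) := by
  calc ∑ i ∈ I, |x i| * |y i| ≤ ∑ _i ∈ I, a * b := by
        refine Finset.sum_le_sum fun i _ => ?_
        exact mul_le_mul (hx i) (hy i) (abs_nonneg _) ha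
    _ = I.card * (a * b) := by simp
    _ ≤ h * (a * b) := by gcongr

/-- Parameters of an error analysis: all dimensions are at most `h`, both precisions have entrywise
error bound `γ`, and `η` is the resulting unit for errors in norm. -/
structure ErrUnit (εl εh γ η : ℝ) (h : ℕ) : Prop where
  low : DotBound εl γ h
  high : DotBound εh γ h
  pos : 1 ≤ h
  le : 1000 * (h : ℝ) ^ 3 * γ ≤ η
  small : η ≤ 1 / 100

namespace ErrUnit

variable {εl εh γ η : ℝ} {h : ℕ}

theorem one_le (H : ErrUnit εl εh γ η h) : (1 : ℝ) ≤ h := by exact_mod_cast H.pos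

theorem γ_nonneg (H : ErrUnit εl εh γ η h) : 0 ≤ γ := H.low.nonneg'

theorem η_nonneg (H : ErrUnit εl εh γ η h) : 0 ≤ η := by
  have := H.γ_nonneg
  exact le_trans (by positivity) H.le

theorem sq_le (H : ErrUnit εl εh γ η h) : 1000 * (h : ℝ) ^ 2 * γ ≤ η := by
  refine le_trans ?_ H.le
  have := H.γ_nonneg
  have := H.one_le
  gcongr
  linarith

theorem lin_le (H : ErrUnit εl εh γ η h) : 1000 * (h : ℝ) * γ ≤ η := by
  refine le_trans ?_ H.sq_le
  have := H.γ_nonneg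
  have := H.one_le
  have : (h : ℝ) ≤ h ^ 2 := by nlinarith
  gcongr

theorem γ_le (H : ErrUnit εl εh γ η h) : 1000 * γ ≤ η := by
  refine le_trans ?_ H.lin_le
  have := H.γ_nonneg
  have := H.one_le
  nlinarith

theorem norm_le {α β : Type} [Fintype α] [Fintype β] [DecidableEq α] [DecidableEq β]
    (H : ErrUnit εl εh γ η h) {E : Matrix α β ℝ} {c : ℝ} (hc : 0 ≤ c)
    (hα : Fintype.card α ≤ h) (hβ : Fintype.card β ≤ h)
    (hE : ∀ i j, |E i j| ≤ 1000 * h * γ * c) : ‖E‖ ≤ η * c := by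
  have h0 := H.γ_nonneg
  have h1 := norm_le_of_entry (by positivity) hE hα hβ
  calc ‖E‖ ≤ h * (1000 * h * γ * c) := h1
    _ = (1000 * h ^ 2 * γ) * c := by ring
    _ ≤ η * c := by gcongr; exact H.sq_le

end ErrUnit

/-! ### Rounding errors of the separate steps of a projection -/

namespace FlPIP

variable {m s h : ℕ} {ι : Type} [Fintype ι] [DecidableEq ι] {εl εh γ η N : ℝ}
  {Q : Matrix (Fin m) ι ℝ} {X V U : Matrix (Fin m) (Fin s) ℝ} {S : Matrix ι (Fin s) ℝ}
  {G Ω A : Matrix (Fin s) (Fin s) ℝ} {d : Fin s → ℝ}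

theorem S_bound (P : FlPIP εl εh Q X V U S G Ω A d) (H : ErrUnit εl εh γ η h) (hm : m ≤ h)
    (hs : s ≤ h) (hι : Fintype.card ι ≤ h) (hQ : ‖Q‖ ≤ 2) (hX : ‖X‖ ≤ N) :
    ‖S - Qᵀ * X‖ ≤ η * N := by
  have hN : 0 ≤ N := (norm_nonneg _).trans hX
  have hγ := H.γ_nonneg
  have h1 := H.one_le
  refine H.norm_le hN hι (by simpa using hs) fun i b => ?_
  have e1 := H.low.dot (by simpa using hm) (P.S_eq i b)
  have e2 := sum_abs_mul_abs_le_card (I := Finset.univ) (h := h) (x := fun r => Q r i)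
    (y := fun r => X r b) (by simpa using hm)
    zero_le_two hN (fun r => (abs_entry_le Q r i).trans hQ) (fun r => (abs_entry_le X r b).trans hX)
  calc |(S - Qᵀ * X) i b| = |S i b - ∑ r, Q r i * X r b| := by
        simp [Matrix.mul_apply]
    _ ≤ γ * (h * (2 * N)) := e1.trans (by gcongr)
    _ = 2 * (h * γ * N) := by ring
    _ ≤ 1000 * (h * γ * N) := by gcongr; norm_num
    _ = _ := by ring

theorem S_norm (P : FlPIP εl εh Q X V U S G Ω A d) (H : ErrUnit εl εh γ η h) (hm : m ≤ h)
    (hs : s ≤ h) (hι : Fintype.card ι ≤ h) (hQ : ‖Q‖ ≤ 2) (hX : ‖X‖ ≤ N) : ‖S‖ ≤ 3 * N := by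
  have hN : 0 ≤ N := (norm_nonneg _).trans hX
  have e1 := P.S_bound H hm hs hι hQ hX
  have e2 : ‖Qᵀ * X‖ ≤ 2 * N := by
    refine (norm_mul_le _ _).trans ?_
    rw [norm_transpose]; gcongr
  have e3 := norm_add_le (S - Qᵀ * X) (Qᵀ * X)
  rw [sub_add_cancel] at e3
  nlinarith [H.small]

theorem V_bound (P : FlPIP εl εh Q X V U S G Ω A d) (H : ErrUnit εl εh γ η h) (hm : m ≤ h)
    (hs : s ≤ h) (hι : Fintype.card ι ≤ h) (hQ : ‖Q‖ ≤ 2) (hX : ‖X‖ ≤ N) :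
    ‖V - (X - Q * S)‖ ≤ η * N := by
  have hN : 0 ≤ N := (norm_nonneg _).trans hX
  have hγ := H.γ_nonneg
  have h1 := H.one_le
  have hS := P.S_norm H hm hs hι hQ hX
  refine H.norm_le hN (by simpa using hm) (by simpa using hs) fun r b => ?_
  have e1 := H.low.subDot (by simpa using hι) (P.V_eq r b)
  have e2 := sum_abs_mul_abs_le_card (I := Finset.univ) (h := h) (x := fun i => Q r i)
    (y := fun i => S i b) (by simpa using hι)
    zero_le_two (by positivity) (fun i => (abs_entry_le Q r i).trans hQ)
    (fun i => (abs_entry_le S i b).trans hS)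
  have e3 := (abs_entry_le X r b).trans hX
  calc |(V - (X - Q * S)) r b| = |V r b - (X r b - ∑ i, Q r i * S i b)| := by
        simp [Matrix.mul_apply]
    _ ≤ γ * (N + h * (2 * (3 * N))) := e1.trans (by gcongr)
    _ ≤ γ * (h * N + h * (2 * (3 * N))) := by gcongr; exact le_mul_of_one_le_left hN h1
    _ = 7 * (h * γ * N) := by ring
    _ ≤ 1000 * (h * γ * N) := by gcongr; norm_num
    _ = _ := by ring

/-- The reference matrix uses the computed `S`, so only forming and factoring the matrix are charged
here: `12 h γ N²` for forming it and `20 γ · 10 N²` for the factorization. The error in `S` itself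
is accounted for in `FlPIP.project`. -/
theorem chol_bound (P : FlPIP εl εh Q X V U S G Ω A d) (H : ErrUnit εl εh γ η h) (hm : m ≤ h)
    (hs : s ≤ h) (hι : Fintype.card ι ≤ h) (hQ : ‖Q‖ ≤ 2) (hX : ‖X‖ ≤ N) {lam : ℝ}
    (hlam : 0 < lam) (hη : η * N ^ 2 ≤ lam / 4)
    (hpos : ∀ y, lam * vnorm y ^ 2 ≤ y ⬝ᵥ ((Xᵀ * X - Sᵀ * S) *ᵥ y)) :
    (∀ j, 0 < d j) ∧ (∀ j, G j j ≠ 0) ∧ ‖Gᵀ * G - (Xᵀ * X - Sᵀ * S)‖ ≤ η * N ^ 2 := by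
  have hN : 0 ≤ N := (norm_nonneg _).trans hX
  have hγ := H.γ_nonneg
  have h1 := H.one_le
  have hS := P.S_norm H hm hs hι hQ hX
  have hη1 := H.small
  set K := Xᵀ * X - Sᵀ * S with hK
  have hKs : ∀ a b, K a b = K b a := by
    intro a b; simp [K, Matrix.mul_apply, mul_comm]
  have hKn : ‖K‖ ≤ 10 * N ^ 2 := by
    refine (norm_sub_le _ _).trans ?_
    rw [norm_transpose_mul_self, norm_transpose_mul_self]
    have e1 : ‖X‖ ^ 2 ≤ N ^ 2 := by gcongr
    have e2 : ‖S‖ ^ 2 ≤ (3 * N) ^ 2 := by gcongr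
    linarith
  have hA : ∀ a b, |A a b - K a b| ≤ 12 * h * γ * N ^ 2 := by
    intro a b
    have e1 := H.high.dot (by simpa using hm) (P.Ω_eq a b)
    have e2 := sum_abs_mul_abs_le_card (I := Finset.univ) (h := h) (x := fun r => X r a)
      (y := fun r => X r b) (by simpa using hm) hN hN
      (fun i => (abs_entry_le X i a).trans hX) (fun i => (abs_entry_le X i b).trans hX)
    have e3 := H.high.subDot (by simpa using hι) (P.A_eq a b)
    have e4 := sum_abs_mul_abs_le_card (I := Finset.univ) (h := h) (x := fun i => S i a)
      (y := fun i => S i b) (by simpa using hι) (a := 3 * N) (b := 3 * N)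
      (by positivity) (by positivity)
      (fun i => (abs_entry_le S i a).trans hS) (fun i => (abs_entry_le S i b).trans hS)
    have e5 : |∑ r, X r a * X r b| ≤ N ^ 2 := by
      have := (abs_entry_le (Xᵀ * X) a b)
      rw [norm_transpose_mul_self] at this
      have e1 : ‖X‖ ^ 2 ≤ N ^ 2 := by gcongr
      simpa [Matrix.mul_apply] using this.trans e1
    have e6 : |Ω a b - ∑ r, X r a * X r b| ≤ h * γ * N ^ 2 := by
      refine e1.trans ?_
      calc _ ≤ γ * (h * (N * N)) := by gcongr
        _ = _ := by ring
    have e7 : |Ω a b| ≤ 2 * N ^ 2 := by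
      have := abs_sub_abs_le_abs_sub (Ω a b) (∑ r, X r a * X r b)
      have : h * γ * N ^ 2 ≤ 1 * N ^ 2 := by
        gcongr
        linarith [H.lin_le]
      linarith
    have e8 : |A a b - (Ω a b - ∑ i, S i a * S i b)| ≤ 11 * h * γ * N ^ 2 := by
      refine e3.trans ?_
      calc _ ≤ γ * (2 * N ^ 2 + h * (3 * N * (3 * N))) := by gcongr
        _ ≤ γ * (h * (2 * N ^ 2) + h * (3 * N * (3 * N))) := by
            have := le_mul_of_one_le_left (show 0 ≤ 2 * N ^ 2 by positivity) h1
            exact mul_le_mul_of_nonneg_left (by linarith) hγ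
        _ = _ := by ring
    have e9 : A a b - K a b = (A a b - (Ω a b - ∑ i, S i a * S i b)) +
        (Ω a b - ∑ r, X r a * X r b) := by
      simp [K, Matrix.mul_apply]; ring
    rw [e9]
    refine (abs_add_le _ _).trans ?_
    linarith
  have he : 12 * h * γ * N ^ 2 + 20 * γ * (10 * N ^ 2) ≤ 212 * h * γ * N ^ 2 := by
    have : γ * N ^ 2 ≤ h * (γ * N ^ 2) := le_mul_of_one_le_left (by positivity) h1
    linarith
  have hs' : (s : ℝ) ≤ h := by exact_mod_cast hs
  have hgA : 0 ≤ 12 * h * γ * N ^ 2 := by positivity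
  have hbound := P.chol.bound H.high hs (by linarith [H.γ_le]) (H := K) (M := 10 * N ^ 2)
    (gA := 12 * h * γ * N ^ 2) hlam hgA (fun a b => (abs_entry_le K a b).trans hKn)
    (fun a b _ => hA a b) (by
      calc _ ≤ h * (212 * h * γ * N ^ 2) := by gcongr
        _ = 212 * h ^ 2 * γ * N ^ 2 := by ring
        _ ≤ (1000 * h ^ 2 * γ) * N ^ 2 := by gcongr; norm_num
        _ ≤ η * N ^ 2 := by gcongr; exact H.sq_le
        _ ≤ _ := hη) hKs (fun y => by
      have := hpos y
      rw [vnorm_sq'] at this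
      refine this.trans (le_of_eq ?_)
      simp [dotProduct, Matrix.mulVec, Finset.mul_sum, mul_assoc])
  refine ⟨fun j => (hbound j).1, fun j => (hbound j).2.1, ?_⟩
  refine H.norm_le (by positivity) (by simpa using hs) (by simpa using hs) fun a b => ?_
  have hle : 12 * h * γ * N ^ 2 + 20 * γ * (10 * N ^ 2) ≤ 1000 * h * γ * N ^ 2 := by
    refine he.trans ?_
    gcongr; norm_num
  refine le_trans ?_ hle
  rcases le_total a b with hab | hab
  · simpa [Matrix.mul_apply] using (hbound b).2.2.1 a hab
  · have := (hbound a).2.2.1 b hab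
    rw [← hKs] at this
    simpa [Matrix.mul_apply, mul_comm] using this

end FlPIP

/-! ### Triangular substitution and perturbed Gram matrices -/

/-- Substitution has a small residual relative to `‖U‖ ‖G‖`, so no condition number of `G` appears.
The final cast is a relative perturbation of each entry, which allows the bound to be stated with
`U` in place of the uncast `Z`. -/
theorem FlRightSolve.bound {m s h : ℕ} {εl εh γ η : ℝ} {V U : Matrix (Fin m) (Fin s) ℝ}
    {G : Matrix (Fin s) (Fin s) ℝ} (P : FlRightSolve εl εh V G U) (H : ErrUnit εl εh γ η h)
    (hm : m ≤ h) (hs : s ≤ h) (hG : ∀ i j, j < i → G i j = 0) (hd : ∀ j, G j j ≠ 0) :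
    ‖U * G - V‖ ≤ η * (‖V‖ + ‖U‖ * ‖G‖) := by
  obtain ⟨Z, hZ⟩ := P
  have hγ := H.γ_nonneg
  have h1 := H.one_le
  have hγ1 : γ ≤ 1 / 100 := by linarith [H.γ_le, H.small]
  have hv := norm_nonneg V
  have hu := norm_nonneg U
  have hg := norm_nonneg G
  have hug : 0 ≤ ‖U‖ * ‖G‖ := by positivity
  refine H.norm_le (by positivity) (by simpa using hm) (by simpa using hs) fun r j => ?_
  obtain ⟨⟨t, ht, hz⟩, -⟩ := hZ r j
  have hZU : ∀ l, |U r l - Z r l| ≤ 2 * γ * ‖U‖ ∧ |Z r l| ≤ 2 * ‖U‖ := by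
    intro l
    have e1 := (hZ r l).2.abs_sub_le
    have e2 : |U r l - Z r l| ≤ γ * |Z r l| := e1.trans (by gcongr; exact H.low.le)
    have e3 := abs_entry_le U r l
    have e4 := abs_sub_abs_le_abs_sub (Z r l) (U r l)
    rw [abs_sub_comm] at e4
    have e5 : |Z r l| ≤ 2 * ‖U‖ := by nlinarith [abs_nonneg (Z r l)]
    refine ⟨e2.trans ?_, e5⟩
    calc γ * |Z r l| ≤ γ * (2 * ‖U‖) := by gcongr
      _ = _ := by ring
  have hcard : (Finset.Iio j).card ≤ h := by rw [Fin.card_Iio]; omega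
  have e1 := H.high.subDot hcard ht
  have e2 := sum_abs_mul_abs_le_card hcard (x := fun l => Z r l) (y := fun l => G l j)
    (by positivity) hg (fun l => (hZU l).2) (fun l => abs_entry_le G l j)
  have e3 := abs_entry_le V r j
  set B := ‖V‖ + h * (2 * ‖U‖ * ‖G‖) with hB
  have hB0 : 0 ≤ B := by positivity
  have e4 : |t - (V r j - ∑ l ∈ Finset.Iio j, Z r l * G l j)| ≤ γ * B :=
    e1.trans (mul_le_mul_of_nonneg_left (add_le_add e3 e2) hγ)
  have e5 : |∑ l ∈ Finset.Iio j, Z r l * G l j| ≤ h * (2 * ‖U‖ * ‖G‖) :=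
    (Finset.abs_sum_le_sum_abs _ _).trans (by simpa [abs_mul] using e2)
  have e6 : |t| ≤ 2 * B := by
    have := abs_le.1 e4
    have := abs_le.1 e5
    have := abs_le.1 e3
    have : γ * B ≤ 1 * B := by gcongr; linarith
    rw [abs_le]; constructor <;> linarith
  have e7 : |Z r j * G j j - t| ≤ γ * (2 * B) := by
    obtain ⟨δ, hδ, hx⟩ := hz
    have := hd j
    rw [hx, show t / G j j * (1 + δ) * G j j - t = δ * t by field_simp; ring, abs_mul]
    gcongr
    exact hδ.trans H.high.le
  have e8 : ∑ l, Z r l * G l j = ∑ l ∈ Finset.Iio j, Z r l * G l j + Z r j * G j j := by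
    rw [← Finset.sum_subset (Finset.subset_univ (Finset.Iic j)), ← Finset.Iio_insert,
      Finset.sum_insert (by simp), add_comm]
    intro x _ hx
    rw [hG x j (by simpa using hx), mul_zero]
  have e9 : |∑ l, (U r l - Z r l) * G l j| ≤ h * (2 * γ * ‖U‖ * ‖G‖) := by
    refine (Finset.abs_sum_le_sum_abs _ _).trans ?_
    simp only [abs_mul]
    exact sum_abs_mul_abs_le_card (by simpa using hs) (by positivity) hg (fun l => (hZU l).1)
      (fun l => abs_entry_le G l j)
  have e10 : (U * G - V) r j = ∑ l, (U r l - Z r l) * G l j + (Z r j * G j j - t) +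
      (t - (V r j - ∑ l ∈ Finset.Iio j, Z r l * G l j)) := by
    simp only [Matrix.sub_apply, Matrix.mul_apply, sub_mul, Finset.sum_sub_distrib, e8]
    ring
  rw [e10]
  refine (abs_add_three _ _ _).trans ?_
  have e11 : γ * ‖V‖ ≤ h * (γ * ‖V‖) := le_mul_of_one_le_left (by positivity) h1
  calc _ ≤ h * (2 * γ * ‖U‖ * ‖G‖) + γ * (2 * B) + γ * B := by gcongr
    _ = 3 * (γ * ‖V‖) + 8 * (h * γ * (‖U‖ * ‖G‖)) := by rw [hB]; ring
    _ ≤ 1000 * (h * (γ * ‖V‖)) + 1000 * (h * γ * (‖U‖ * ‖G‖)) := by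
        have : 0 ≤ h * (γ * ‖V‖) := by positivity
        have : 0 ≤ h * γ * (‖U‖ * ‖G‖) := by positivity
        linarith
    _ = _ := by ring

section

variable {ι κ α : Type} [Fintype ι] [Fintype κ] [DecidableEq ι] [DecidableEq κ]
  [Fintype α] [DecidableEq α]

theorem norm_mul_le_of_le {A : Matrix ι κ ℝ} {B : Matrix κ α ℝ} {a b : ℝ} (hA : ‖A‖ ≤ a)
    (hB : ‖B‖ ≤ b) : ‖A * B‖ ≤ a * b :=
  (norm_mul_le A B).trans (mul_le_mul hA hB (norm_nonneg _) ((norm_nonneg _).trans hA))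

theorem norm_transpose_mul_le {A : Matrix κ ι ℝ} {B : Matrix κ α ℝ} {a b : ℝ} (hA : ‖A‖ ≤ a)
    (hB : ‖B‖ ≤ b) : ‖Aᵀ * B‖ ≤ a * b :=
  norm_mul_le_of_le (by rwa [norm_transpose]) hB

theorem norm_le_of_one_sub_gram {A : Matrix ι κ ℝ} {δ c : ℝ} (h : ‖1 - Aᵀ * A‖ ≤ δ) (hc : 0 ≤ c)
    (hδ : 1 + δ ≤ c ^ 2) : ‖A‖ ≤ c := by
  have h1 := norm_sub_le (1 : Matrix κ κ ℝ) (1 - Aᵀ * A)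
  rw [sub_sub_cancel, norm_transpose_mul_self] at h1
  have := norm_one_le (ι := κ)
  exact le_of_sq_le_sq (by linarith) hc

theorem norm_one_sub_gram_mul_inv_le {G : Matrix κ κ ℝ} {W : Matrix ι κ ℝ} {c ρ : ℝ}
    (hG : IsUnit G.det) (h : ‖Gᵀ * G - Wᵀ * W‖ ≤ c) (hρ : ‖G⁻¹‖ ≤ ρ) :
    ‖1 - (W * G⁻¹)ᵀ * (W * G⁻¹)‖ ≤ ρ ^ 2 * c := by
  have e0 : G * G⁻¹ = 1 := Matrix.mul_nonsing_inv _ hG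
  have e1 : (1 : Matrix κ κ ℝ) = (G * G⁻¹)ᵀ * (G * G⁻¹) := by rw [e0]; simp
  have e2 : 1 - (W * G⁻¹)ᵀ * (W * G⁻¹) = (G⁻¹)ᵀ * ((Gᵀ * G - Wᵀ * W) * G⁻¹) := by
    rw [e1]
    simp only [Matrix.transpose_mul, Matrix.sub_mul, Matrix.mul_sub, Matrix.mul_assoc]
  rw [e2]
  refine (norm_transpose_mul_le hρ (norm_mul_le_of_le h hρ)).trans (le_of_eq (by ring))

end

/-- One projection turns `X` into an almost orthonormal `U`, almost orthogonal to `Q`. -/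
theorem FlPIP.project {m s h : ℕ} {ι : Type} [Fintype ι] [DecidableEq ι] {εl εh γ η N δ σ : ℝ}
    {Q : Matrix (Fin m) ι ℝ} {X V U : Matrix (Fin m) (Fin s) ℝ} {S : Matrix ι (Fin s) ℝ}
    {G Ω A : Matrix (Fin s) (Fin s) ℝ} {d : Fin s → ℝ}
    (P : FlPIP εl εh Q X V U S G Ω A d) (H : ErrUnit εl εh γ η h) (hm : m ≤ h)
    (hs : s ≤ h) (hι : Fintype.card ι ≤ h) (hQ : ‖1 - Qᵀ * Q‖ ≤ δ) (hδ : δ ≤ 1)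
    (hX : ‖X‖ ≤ N) (hσ : 0 < σ) (hσN : σ ≤ N) (hlow : LowerBound σ (X - Q * S))
    (hsmall : 1000 * (η + δ) * N ^ 2 ≤ σ ^ 2) :
    (∀ j, 0 < d j) ∧ ‖G‖ ≤ 4 * N ∧ ‖U‖ ≤ 3 / 2 ∧
      ‖1 - Uᵀ * U‖ ≤ 4 / σ ^ 2 * (300 * η * N ^ 2 + δ * ‖S‖ ^ 2) ∧
      ‖Qᵀ * U‖ ≤ 2 / σ * (31 * η * N + δ * ‖S‖) ∧
      ‖U * G + Q * S - X‖ ≤ 15 * η * N := by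
  have hN : 0 < N := hσ.trans_le hσN
  have hη := H.η_nonneg
  have hη1 := H.small
  have hδ0 : 0 ≤ δ := (norm_nonneg _).trans hQ
  have hQ2 : ‖Q‖ ≤ 2 := norm_le_of_one_sub_gram hQ zero_le_two (by linarith)
  have hES := P.S_bound H hm hs hι hQ2 hX
  have hS := P.S_norm H hm hs hι hQ2 hX
  have hEV := P.V_bound H hm hs hι hQ2 hX
  set Y := X - Q * S with hY
  set E := S - Qᵀ * X with hE
  set K := Xᵀ * X - Sᵀ * S with hK
  have hS0 := norm_nonneg S
  have hηN2 : 0 ≤ η * N ^ 2 := by positivity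
  have hδN2 : 0 ≤ δ * N ^ 2 := by positivity
  have hS2 : ‖S‖ ^ 2 ≤ 9 * N ^ 2 := by
    calc ‖S‖ ^ 2 ≤ (3 * N) ^ 2 := by gcongr
      _ = _ := by ring
  have hδS2 : δ * ‖S‖ ^ 2 ≤ 9 * (δ * N ^ 2) := by
    calc δ * ‖S‖ ^ 2 ≤ δ * (9 * N ^ 2) := by gcongr
      _ = _ := by ring
  -- the Gram matrix of the projected block
  have hYK : ‖Yᵀ * Y - K‖ ≤ 6 * (η * N ^ 2) + δ * ‖S‖ ^ 2 := by
    -- Substituting `Qᵀ X = S - E` separates the two defects of the Pythagorean identity: the error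
    -- `E` in `S` and the loss of orthogonality of `Q`.
    have e1 : Yᵀ * Y - K = Eᵀ * S + Sᵀ * E - Sᵀ * ((1 - Qᵀ * Q) * S) := by
      simp only [hY, hE, hK, Matrix.transpose_sub, Matrix.transpose_mul, Matrix.sub_mul,
        Matrix.mul_sub, Matrix.mul_assoc, Matrix.transpose_transpose, Matrix.one_mul]
      abel
    have e2 : ‖Eᵀ * S‖ ≤ η * N * (3 * N) := norm_transpose_mul_le hES hS
    have e3 : ‖Sᵀ * E‖ ≤ 3 * N * (η * N) := norm_transpose_mul_le hS hES
    have e4 : ‖Sᵀ * ((1 - Qᵀ * Q) * S)‖ ≤ ‖S‖ * (δ * ‖S‖) :=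
      norm_transpose_mul_le le_rfl (norm_mul_le_of_le hQ le_rfl)
    have e5 := norm_sub_le (Eᵀ * S + Sᵀ * E) (Sᵀ * ((1 - Qᵀ * Q) * S))
    have e6 := norm_add_le (Eᵀ * S) (Sᵀ * E)
    rw [e1]
    linarith
  have hquad : ∀ y, σ ^ 2 / 2 * vnorm y ^ 2 ≤ y ⬝ᵥ (K *ᵥ y) :=
    hlow.quad hσ.le (by linarith)
  obtain ⟨hd, hGd, hGK⟩ := P.chol_bound H hm hs hι hQ2 hX (by positivity) (by linarith) hquad
  have hGlow : LowerBound (σ / 2) G :=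
    lowerBound_of_quad (by positivity) hquad (by linarith)
  have hσ2 : 0 < σ / 2 := by positivity
  have hGu := hGlow.isUnit_det hσ2
  have hGi : ‖G⁻¹‖ ≤ 2 / σ := (hGlow.norm_inv_le hσ2).trans (le_of_eq (by field_simp))
  have hGG : G * G⁻¹ = 1 := Matrix.mul_nonsing_inv _ hGu
  have hGN : ‖G‖ ≤ 4 * N := by
    have e1 : ‖K‖ ≤ 10 * N ^ 2 := by
      have e2 := norm_sub_le (Xᵀ * X) (Sᵀ * S)
      rw [norm_transpose_mul_self, norm_transpose_mul_self] at e2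
      have : ‖X‖ ^ 2 ≤ N ^ 2 := by gcongr
      linarith
    have e2 := norm_add_le (Gᵀ * G - K) K
    rw [sub_add_cancel, norm_transpose_mul_self] at e2
    refine le_of_sq_le_sq ?_ (by positivity)
    nlinarith [sq_nonneg N]
  have hY7 : ‖Y‖ ≤ 7 * N := by
    have e1 := norm_sub_le X (Q * S)
    have e2 := norm_mul_le_of_le hQ2 hS
    linarith
  have hηN : η * N ≤ σ / 1000 := by
    have : η * N * σ ≤ η * N * N := by gcongr
    have : σ * (η * N) ≤ σ * (σ / 1000) := by nlinarith
    exact le_of_mul_le_mul_left this hσ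
  have hV : ‖V‖ ≤ 8 * N := by
    have e1 := norm_add_le (V - Y) Y
    rw [sub_add_cancel] at e1
    nlinarith
  have hF := P.U_eq.bound H hm hs P.chol.lower hGd
  have hU0 := norm_nonneg U
  have hηN0 : 0 ≤ η * N := by positivity
  have hP : ‖U * G - Y‖ ≤ η * N * (9 + 4 * ‖U‖) := by
    have e1 := norm_add_le (U * G - V) (V - Y)
    rw [sub_add_sub_cancel] at e1
    have e2 : η * (‖V‖ + ‖U‖ * ‖G‖) ≤ η * (8 * N + ‖U‖ * (4 * N)) := by gcongr
    linarith
  have hGY : ‖Gᵀ * G - Yᵀ * Y‖ ≤ 7 * (η * N ^ 2) + δ * ‖S‖ ^ 2 := by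
    have e1 := norm_sub_le (Gᵀ * G - K) (Yᵀ * Y - K)
    rw [sub_sub_sub_cancel_right] at e1
    linarith
  -- The error of `U` is bounded in terms of `‖U‖` itself, but with the small factor `4/500`, so the
  -- inequality can be solved for `‖U‖`.
  have hU : ‖U‖ ≤ 3 / 2 := by
    have e1 := norm_one_sub_gram_mul_inv_le hGu hGY hGi
    have e2 : (2 / σ) ^ 2 * (7 * (η * N ^ 2) + δ * ‖S‖ ^ 2) ≤ 1 / 10 := by
      calc _ ≤ (2 / σ) ^ 2 * (σ ^ 2 / 100) := by gcongr; linarith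
        _ ≤ _ := by field_simp; norm_num
    have e3 : ‖Y * G⁻¹‖ ≤ 6 / 5 :=
      norm_le_of_one_sub_gram (e1.trans e2) (by norm_num) (by norm_num)
    have e4 : U = Y * G⁻¹ + (U * G - Y) * G⁻¹ := by
      rw [← Matrix.add_mul, add_sub_cancel, Matrix.mul_assoc, hGG, Matrix.mul_one]
    have e5 : ‖(U * G - Y) * G⁻¹‖ ≤ (9 + 4 * ‖U‖) / 500 := by
      refine (norm_mul_le_of_le hP hGi).trans ?_
      calc _ ≤ σ / 1000 * (9 + 4 * ‖U‖) * (2 / σ) := by gcongr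
        _ = _ := by field_simp; ring
    have e6 := norm_add_le (Y * G⁻¹) ((U * G - Y) * G⁻¹)
    rw [← e4] at e6
    linarith
  have hP' : ‖U * G - Y‖ ≤ 15 * η * N := by
    refine hP.trans ?_
    calc _ ≤ η * N * (9 + 4 * (3 / 2)) := by gcongr
      _ = _ := by ring
  have hUG : (U * G) * G⁻¹ = U := by rw [Matrix.mul_assoc, hGG, Matrix.mul_one]
  refine ⟨hd, hGN, hU, ?_, ?_, ?_⟩
  -- The constant `300` covers `7 + 105 + 105` and the quadratic term. The term `δ ‖S‖²` is kept
  -- apart because the coefficient block is tiny in the second projection.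
  · have e1 : Gᵀ * G - (U * G)ᵀ * (U * G) = (Gᵀ * G - Yᵀ * Y) - (Yᵀ * (U * G - Y)
        + (U * G - Y)ᵀ * Y + (U * G - Y)ᵀ * (U * G - Y)) := by
      simp only [Matrix.transpose_sub, Matrix.sub_mul, Matrix.mul_sub]
      abel
    have e2 : ‖Yᵀ * (U * G - Y)‖ ≤ 7 * N * (15 * η * N) := norm_transpose_mul_le hY7 hP'
    have e3 : ‖(U * G - Y)ᵀ * Y‖ ≤ 15 * η * N * (7 * N) := norm_transpose_mul_le hP' hY7
    have e4 : ‖(U * G - Y)ᵀ * (U * G - Y)‖ ≤ 15 * η * N * (15 * η * N) :=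
      norm_transpose_mul_le hP' hP'
    have e5 := norm_sub_le (Gᵀ * G - Yᵀ * Y) (Yᵀ * (U * G - Y)
        + (U * G - Y)ᵀ * Y + (U * G - Y)ᵀ * (U * G - Y))
    have e6 := norm_add₃_le (a := Yᵀ * (U * G - Y)) (b := (U * G - Y)ᵀ * Y)
      (c := (U * G - Y)ᵀ * (U * G - Y))
    have e7 : η * (η * N ^ 2) ≤ 1 / 100 * (η * N ^ 2) := by gcongr
    have e8 := norm_one_sub_gram_mul_inv_le hGu
      (c := 300 * η * N ^ 2 + δ * ‖S‖ ^ 2) (W := U * G) (by rw [e1]; linarith) hGi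
    rw [hUG] at e8
    refine e8.trans (le_of_eq ?_)
    rw [div_pow]; norm_num
  · have e1 : Qᵀ * (U * G) = (1 - Qᵀ * Q) * S - E + Qᵀ * (U * G - Y) := by
      simp only [hY, hE, Matrix.sub_mul, Matrix.mul_sub, Matrix.one_mul, Matrix.mul_assoc]
      abel
    have e2 : ‖(1 - Qᵀ * Q) * S‖ ≤ δ * ‖S‖ := norm_mul_le_of_le hQ le_rfl
    have e3 : ‖Qᵀ * (U * G - Y)‖ ≤ 2 * (15 * η * N) := norm_transpose_mul_le hQ2 hP'
    have e4 := norm_add_le ((1 - Qᵀ * Q) * S - E) (Qᵀ * (U * G - Y))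
    have e5 := norm_sub_le ((1 - Qᵀ * Q) * S) E
    have e6 : ‖Qᵀ * (U * G)‖ ≤ 31 * η * N + δ * ‖S‖ := by rw [e1]; linarith
    have e7 := norm_mul_le_of_le e6 hGi
    rw [Matrix.mul_assoc, hUG] at e7
    linarith
  · have : U * G + Q * S - X = U * G - Y := by rw [hY]; abel
    rw [this]; exact hP'

/-! ### Projection with reorthogonalization -/

/-- Projecting twice makes the new block orthogonal up to a fixed multiple of the error unit,
no matter how large the previous loss of orthogonality `D η` is. -/
theorem FlPIP.project_twice {m s h : ℕ} {ι : Type} [Fintype ι] [DecidableEq ι]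
    {εl εh γ η N δ σ D : ℝ}
    {Q : Matrix (Fin m) ι ℝ} {X V U W Q' : Matrix (Fin m) (Fin s) ℝ} {S T : Matrix ι (Fin s) ℝ}
    {G G' Ω Ω' A A' : Matrix (Fin s) (Fin s) ℝ} {d e : Fin s → ℝ}
    (P : FlPIP εl εh Q X V U S G Ω A d) (P' : FlPIP εl εh Q U W Q' T G' Ω' A' e)
    (H : ErrUnit εl εh γ η h) (hm : m ≤ h) (hs : s ≤ h) (hι : Fintype.card ι ≤ h)
    (hQ : ‖1 - Qᵀ * Q‖ ≤ δ) (hD : 1 ≤ D) (hδ : δ ≤ D * η)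
    (hX : ‖X‖ ≤ N) (hσ : 0 < σ) (hσN : σ ≤ N) (hlow : LowerBound (σ / 2) (X - Q * S))
    (hsmall : 1000000 * D ^ 2 * η * N ^ 2 ≤ σ ^ 2) :
    (∀ j, 0 < d j ∧ 0 < e j) ∧ ‖S‖ ≤ 3 * N ∧ ‖T‖ ≤ 1 ∧ ‖G‖ ≤ 4 * N ∧ ‖G'‖ ≤ 8 ∧ ‖Q'‖ ≤ 3 / 2 ∧
      ‖1 - Q'ᵀ * Q'‖ ≤ 19600 * η ∧ ‖Qᵀ * Q'‖ ≤ 300 * η ∧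
      ‖Q * (S + T * G) + Q' * (G' * G) - X‖ ≤ 140 * η * N := by
  have hN : 0 < N := hσ.trans_le hσN
  have hη := H.η_nonneg
  have hδ0 : 0 ≤ δ := (norm_nonneg _).trans hQ
  -- everything in terms of the ratio `q = N / σ`
  obtain ⟨q, rfl⟩ : ∃ q, N = q * σ := ⟨N / σ, by field_simp⟩
  have hq : 1 ≤ q := by
    by_contra! hq
    nlinarith
  have hq0 : 0 ≤ q := by linarith
  have hD0 : 0 ≤ D := by linarith
  have hsm : D ^ 2 * η * q ^ 2 ≤ 1 / 1000000 := by
    have : σ ^ 2 * (1000000 * (D ^ 2 * η * q ^ 2)) ≤ σ ^ 2 * 1 := by linarith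
    have := le_of_mul_le_mul_left this (by positivity)
    linarith
  have hDq2 : D * η * q ^ 2 ≤ 1 / 1000000 := by
    refine le_trans ?_ hsm
    gcongr
    nlinarith
  have hD2q : D ^ 2 * η * q ≤ 1 / 1000000 := by
    refine le_trans ?_ hsm
    gcongr
    nlinarith
  have hDq : D * η * q ≤ 1 / 1000000 := by
    refine le_trans ?_ hD2q
    gcongr
    nlinarith
  have hDη : D * η ≤ 1 / 1000000 := le_trans (le_mul_of_one_le_right (by positivity) hq) hDq
  have hηD : η ≤ D * η := le_mul_of_one_le_left hη hD
  have hηDq : η ≤ D * η * q := hηD.trans (le_mul_of_one_le_right (by positivity) hq)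
  have hδ1 : δ ≤ 1 / 1000000 := hδ.trans hDη
  have hQ2 : ‖Q‖ ≤ 2 := norm_le_of_one_sub_gram hQ zero_le_two (by linarith)
  have hS := P.S_norm H hm hs hι hQ2 hX
  -- first projection
  obtain ⟨hd, hG, hU, hUU, hQU, hR1⟩ := P.project H hm hs hι hQ (by linarith) hX
    (show 0 < σ / 2 by positivity) (by linarith) hlow (by
      have : (η + δ) ≤ 2 * (D * η) := by linarith
      calc 1000 * (η + δ) * (q * σ) ^ 2 ≤ 1000 * (2 * (D * η)) * (q * σ) ^ 2 := by gcongr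
        _ = 2000 * (D * η * q ^ 2) * σ ^ 2 := by ring
        _ ≤ 2000 * (1 / 1000000) * σ ^ 2 := by gcongr
        _ ≤ _ := by nlinarith [sq_nonneg σ])
  have hUU' : ‖1 - Uᵀ * U‖ ≤ 1 / 10 := by
    refine hUU.trans ?_
    calc 4 / (σ / 2) ^ 2 * (300 * η * (q * σ) ^ 2 + δ * ‖S‖ ^ 2)
        ≤ 4 / (σ / 2) ^ 2 * (300 * (D * η) * (q * σ) ^ 2 + D * η * (3 * (q * σ)) ^ 2) := by gcongr
      _ = 4944 * (D * η * q ^ 2) := by field_simp; ring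
      _ ≤ _ := by linarith
  have hQU' : ‖Qᵀ * U‖ ≤ 136 * (D * η * q) := by
    refine hQU.trans ?_
    calc 2 / (σ / 2) * (31 * η * (q * σ) + δ * ‖S‖)
        ≤ 2 / (σ / 2) * (31 * (D * η) * (q * σ) + D * η * (3 * (q * σ))) := by gcongr
      _ = 136 * (D * η * q) := by field_simp; ring
  -- second projection
  have hU2 : ‖U‖ ≤ 2 := by linarith
  have hT : ‖T‖ ≤ 138 * (D * η * q) := by
    have e1 := P'.S_bound H hm hs hι hQ2 hU2
    have e2 := norm_add_le (T - Qᵀ * U) (Qᵀ * U)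
    rw [sub_add_cancel] at e2
    linarith
  -- The second pass starts from a well-conditioned block: the ratio of norm bound to lower bound is
  -- now `4` instead of a multiple of `q`.
  have hlow' : LowerBound (1 / 2) (U - Q * T) := by
    have e1 : LowerBound (9 / 10) U :=
      lowerBound_of_quad (H := 1) (lam := 1) (by norm_num) (fun y => by
        rw [Matrix.one_mulVec, vnorm_sq, one_mul]) (by
        rw [norm_sub_rev]; linarith)
    refine e1.sub.mono ?_
    have := norm_mul_le_of_le hQ2 hT
    linarith
  obtain ⟨he, hG', hQ', hQQ, hQQ', hR2⟩ := P'.project H hm hs hι hQ (by linarith) hU2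
    (show (0 : ℝ) < 1 / 2 by norm_num) (by norm_num) hlow' (by linarith)
  have hT0 := norm_nonneg T
  -- The decisive gain: the old loss of orthogonality is multiplied by `T`, which is itself of order
  -- `D η q`. The smallness of `D² η q` removes `D` from every later bound. With `N = 2` and `σ =
  -- 1/2` this leaves `16 · 1201` and `4 · 63` error units, within `19600` and `300`.
  have hδT : δ * ‖T‖ ≤ η := by
    calc δ * ‖T‖ ≤ (D * η) * (138 * (D * η * q)) := by gcongr
      _ = 138 * (D ^ 2 * η * q) * η := by ring
      _ ≤ 1 * η := by gcongr; linarith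
      _ = η := one_mul η
  have hT1 : ‖T‖ ≤ 1 := by linarith
  have hδT2 : δ * ‖T‖ ^ 2 ≤ η := by
    calc δ * ‖T‖ ^ 2 = (δ * ‖T‖) * ‖T‖ := by ring
      _ ≤ η * 1 := by gcongr
      _ = η := mul_one η
  refine ⟨fun j => ⟨hd j, he j⟩, hS, hT1, hG, by linarith, hQ', ?_, ?_, ?_⟩
  · refine hQQ.trans ?_
    norm_num
    linarith
  · refine hQQ'.trans ?_
    norm_num
    linarith
  -- The residual of the second pass is amplified only by `‖G‖ ≤ 4 N`, so the total is at most `30 ·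
  -- 4 + 15` units.
  · have e1 : Q * (S + T * G) + Q' * (G' * G) - X =
        (Q' * G' + Q * T - U) * G + (U * G + Q * S - X) := by
      simp only [Matrix.add_mul, Matrix.sub_mul, Matrix.mul_add, Matrix.mul_assoc]
      abel
    have e2 := norm_mul_le_of_le hR2 hG
    have e3 := norm_add_le ((Q' * G' + Q * T - U) * G) (U * G + Q * S - X)
    rw [e1]
    have : 0 ≤ η * (q * σ) := by positivity
    linarith

/-- The rounding errors in the assembly of a block column of the triangular factor. -/
theorem assembly_bound {s h : ℕ} {ι : Type} [Fintype ι] [DecidableEq ι] {εl εh γ η N : ℝ}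
    {S T Ro : Matrix ι (Fin s) ℝ} {G G' Gl Rd : Matrix (Fin s) (Fin s) ℝ}
    (H : ErrUnit εl εh γ η h) (hs : s ≤ h) (hι : Fintype.card ι ≤ h) (hN : 0 ≤ N)
    (hS : ‖S‖ ≤ 3 * N) (hT : ‖T‖ ≤ 1) (hG : ‖G‖ ≤ 4 * N) (hG' : ‖G'‖ ≤ 8)
    (hGl : ∀ a b, FlRound εl (G a b) (Gl a b))
    (hRo : ∀ i b, FlAddDot εl (S i b) Finset.univ (fun c => T i c) (fun c => Gl c b) (Ro i b))
    (hRd : ∀ a b, ∃ y, FlDot εh Finset.univ (fun c => G' a c) (fun c => G c b) y ∧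
      FlRound εl y (Rd a b)) :
    ‖Ro - (S + T * G)‖ ≤ η * N ∧ ‖Rd - G' * G‖ ≤ η * N := by
  have hγ := H.γ_nonneg
  have h1 := H.one_le
  have hη1 := H.small
  have hγ1 : γ ≤ 1 := by linarith [H.γ_le]
  have hhγ : 0 ≤ h * γ * N := by positivity
  have hcard : (Finset.univ : Finset (Fin s)).card ≤ h := by simpa using hs
  constructor
  · refine H.norm_le hN hι (by simpa using hs) fun i b => ?_
    have hGe := fun c => (abs_entry_le G c b).trans hG
    have hTe := fun c => (abs_entry_le T i c).trans hT
    have e1 : ∀ c, |Gl c b - G c b| ≤ γ * (4 * N) := fun c =>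
      (hGl c b).abs_sub_le.trans
        (mul_le_mul H.low.le (hGe c) (abs_nonneg _) hγ)
    have e2 : ∀ c, |Gl c b| ≤ 8 * N := fun c => by
      have := abs_sub_abs_le_abs_sub (Gl c b) (G c b)
      have := e1 c
      have := hGe c
      have : γ * (4 * N) ≤ 1 * (4 * N) := by gcongr
      linarith
    have e3 := H.low.addDot hcard (hRo i b)
    have e4 := sum_abs_mul_abs_le_card hcard zero_le_one (by positivity) hTe e2
    have e5 := sum_abs_mul_abs_le_card hcard zero_le_one (by positivity) hTe e1
    have e6 := (abs_entry_le S i b).trans hS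
    -- The product is formed with the cast factor `Gl`; the error of the cast is charged separately.
    have e7 : (Ro - (S + T * G)) i b = (Ro i b - (S i b + ∑ c, T i c * Gl c b)) +
        ∑ c, T i c * (Gl c b - G c b) := by
      simp only [Matrix.sub_apply, Matrix.add_apply, Matrix.mul_apply, mul_sub,
        Finset.sum_sub_distrib]
      ring
    have e8 : |∑ c, T i c * (Gl c b - G c b)| ≤ h * (1 * (γ * (4 * N))) :=
      (Finset.abs_sum_le_sum_abs _ _).trans (by simpa only [abs_mul] using e5)
    have e9 : γ * N ≤ h * (γ * N) := le_mul_of_one_le_left (by positivity) h1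
    have e10 := mul_le_mul_of_nonneg_left (add_le_add e6 e4) hγ
    rw [e7]
    refine (abs_add_le _ _).trans ?_
    linarith
  · refine H.norm_le hN (by simpa using hs) (by simpa using hs) fun a b => ?_
    obtain ⟨y, hy, hr⟩ := hRd a b
    have hGe := fun c => (abs_entry_le G c b).trans hG
    have hGe' := fun c => (abs_entry_le G' a c).trans hG'
    have e1 := H.high.dot hcard hy
    have e2 := sum_abs_mul_abs_le_card hcard (by norm_num) (by positivity) hGe' hGe
    have e3 : |∑ c, G' a c * G c b| ≤ h * (8 * (4 * N)) :=
      (Finset.abs_sum_le_sum_abs _ _).trans (by simpa only [abs_mul] using e2)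
    have e4 := mul_le_mul_of_nonneg_left e2 hγ
    have e5 : |y| ≤ 64 * h * N := by
      have := abs_sub_abs_le_abs_sub y (∑ c, G' a c * G c b)
      have : h * γ * N ≤ h * 1 * N := by gcongr
      linarith
    have e6 : |Rd a b - y| ≤ γ * (64 * h * N) :=
      hr.abs_sub_le.trans (mul_le_mul H.low.le e5 (abs_nonneg _) hγ)
    have e7 : (Rd - G' * G) a b = (Rd a b - y) + (y - ∑ c, G' a c * G c b) := by
      simp [Matrix.mul_apply]
    rw [e7]
    refine (abs_add_le _ _).trans ?_
    linarith

/-! ### The induction over the block columns -/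

theorem LowerBound.le_norm {ι κ : Type} [Fintype ι] [Fintype κ] [DecidableEq κ] [Nonempty κ]
    {A : Matrix ι κ ℝ} {c : ℝ} (h : LowerBound c A) : c ≤ ‖A‖ := by
  classical
  let y : κ → ℝ := Pi.single (Classical.arbitrary κ) 1
  have hy : 0 < vnorm y := by
    refine lt_of_le_of_ne (vnorm_nonneg y) fun h0 => ?_
    have := vnorm_eq_zero.1 h0.symm
    have := congrFun this (Classical.arbitrary κ)
    simp [y] at this
  exact le_of_mul_le_mul_right ((h y).trans (vnorm_mulVec_le A y)) hy

/-- If `Q R` is close to the leading columns of a matrix, then the projection of the remaining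
columns inherits a lower bound. -/
theorem LowerBound.sub_mul {m : ℕ} {ι κ β : Type} [Fintype ι] [Fintype κ] [Fintype β]
    [DecidableEq ι] [DecidableEq κ] [DecidableEq β] {X : Matrix (Fin m) κ ℝ} {σ : ℝ}
    (hX : LowerBound σ X) (hσ : 0 < σ) {f : ι → κ} {g : β → κ} (hf : f.Injective)
    (hg : g.Injective) (hd : ∀ a b, f a ≠ g b) {Q : Matrix (Fin m) ι ℝ} {R : Matrix ι ι ℝ}
    (hr : ‖Q * R - X.submatrix id f‖ < σ / 2) (S : Matrix ι β ℝ) :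
    LowerBound (σ / 2) (X.submatrix id g - Q * S) := by
  have hR : IsUnit R.det := by
    rw [isUnit_iff_ne_zero, ne_eq, ← Matrix.exists_mulVec_eq_zero_iff]
    rintro ⟨v, hv, hv0⟩
    have h1 : LowerBound (σ / 2) (Q * R) := by
      have := (hX.submatrix hf).sub (B := X.submatrix id f - Q * R)
      rw [sub_sub_cancel, norm_sub_rev] at this
      exact this.mono (by linarith)
    exact hv (h1.mulVec_eq_zero (by positivity) (by
      rw [← Matrix.mulVec_mulVec, hv0, Matrix.mulVec_zero]))
  intro y
  -- Since `Q S y = Q R z`, subtracting `Q S y` amounts, up to the residual, to subtracting the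
  -- combination `z` of the leading columns. The difference is `X w`, where `w` has the entries of
  -- `y` and `-z` in disjoint positions, so that `w` dominates both.
  let z : ι → ℝ := R⁻¹ *ᵥ (S *ᵥ y)
  have hz : R *ᵥ z = S *ᵥ y := by
    rw [Matrix.mulVec_mulVec, Matrix.mul_nonsing_inv _ hR, Matrix.one_mulVec]
  let F : Matrix κ ι ℝ := (1 : Matrix κ κ ℝ).submatrix id f
  let G : Matrix κ β ℝ := (1 : Matrix κ κ ℝ).submatrix id g
  have hFF : Fᵀ * F = 1 := by
    ext a b; simp [F, Matrix.mul_apply, Matrix.one_apply, hf.eq_iff]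
  have hGG : Gᵀ * G = 1 := by
    ext a b; simp [G, Matrix.mul_apply, Matrix.one_apply, hg.eq_iff]
  have hFG : Fᵀ * G = 0 := by
    ext a b; simp [F, G, Matrix.mul_apply, Matrix.one_apply, hd]
  have hGF : Gᵀ * F = 0 := by
    ext a b; simp [F, G, Matrix.mul_apply, Matrix.one_apply, (hd _ _).symm]
  have hXF : X * F = X.submatrix id f := by
    ext i j; simp [F, Matrix.mul_apply, Matrix.one_apply]
  have hXG : X * G = X.submatrix id g := by
    ext i j; simp [G, Matrix.mul_apply, Matrix.one_apply]
  let w : κ → ℝ := G *ᵥ y - F *ᵥ z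
  have hwy : vnorm y ≤ vnorm w := by
    have e1 : Gᵀ *ᵥ w = y := by
      simp [w, Matrix.mulVec_sub, Matrix.mulVec_mulVec, hGG, hGF]
    have e2 := vnorm_mulVec_le Gᵀ w
    rw [e1, norm_transpose] at e2
    exact e2.trans (mul_le_of_le_one_left (vnorm_nonneg w) (norm_one_submatrix_le hg))
  have hwz : vnorm z ≤ vnorm w := by
    have e1 : Fᵀ *ᵥ (-w) = z := by
      simp [w, Matrix.mulVec_sub, Matrix.mulVec_mulVec, hFF, hFG]
    have e2 := vnorm_mulVec_le Fᵀ (-w)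
    have e3 : vnorm (-w) = vnorm w := by simp [vnorm]
    rw [e1, norm_transpose, e3] at e2
    exact e2.trans (mul_le_of_le_one_left (vnorm_nonneg w) (norm_one_submatrix_le hf))
  have key : (X.submatrix id g - Q * S) *ᵥ y =
      X *ᵥ w - (Q * R - X.submatrix id f) *ᵥ z := by
    simp only [w, Matrix.sub_mulVec, Matrix.mulVec_sub, Matrix.mulVec_mulVec, hXF, hXG]
    rw [← Matrix.mulVec_mulVec, ← Matrix.mulVec_mulVec, hz]
    abel
  rw [key]
  have e1 := vnorm_sub_ge (X *ᵥ w) ((Q * R - X.submatrix id f) *ᵥ z)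
  have e2 := vnorm_mulVec_le (Q * R - X.submatrix id f) z
  have e3 : ‖Q * R - X.submatrix id f‖ * vnorm z ≤ σ / 2 * vnorm w :=
    mul_le_mul hr.le hwz (vnorm_nonneg z) (by positivity)
  have e4 := hX w
  have e5 : σ / 2 * vnorm y ≤ σ / 2 * vnorm w := by gcongr
  linarith

/-- The triangular factor of an approximate QR factorization is an approximate Cholesky factor. -/
theorem gram_bound {ι κ : Type} [Fintype ι] [Fintype κ] [DecidableEq ι] [DecidableEq κ]
    {Q X : Matrix ι κ ℝ} {R : Matrix κ κ ℝ} {δ ρ : ℝ} (hQ : ‖1 - Qᵀ * Q‖ ≤ δ)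
    (hδ : δ ≤ 1 / 10) (hρ0 : 0 ≤ ρ) (hρ : ρ ≤ 1 / 10) (hr : ‖Q * R - X‖ ≤ ρ * ‖X‖) :
    ‖Rᵀ * R - Xᵀ * X‖ ≤ (2 * δ + 3 * ρ) * ‖X‖ ^ 2 := by
  have hX := norm_nonneg X
  have hδ0 : 0 ≤ δ := (norm_nonneg _).trans hQ
  have e1 : ‖Rᵀ * ((1 - Qᵀ * Q) * R)‖ ≤ ‖R‖ * (δ * ‖R‖) :=
    norm_transpose_mul_le le_rfl (norm_mul_le_of_le hQ le_rfl)
  -- `‖R‖²` is bounded by `δ ‖R‖² + ‖Q R‖²`, and the first term is absorbed on the left.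
  have hR : ‖R‖ ^ 2 ≤ 2 * ‖X‖ ^ 2 := by
    have e2 : ‖Q * R‖ ≤ 11 / 10 * ‖X‖ := by
      have := norm_add_le (Q * R - X) X
      rw [sub_add_cancel] at this
      nlinarith
    have e3 : ‖Q * R‖ ^ 2 ≤ (11 / 10 * ‖X‖) ^ 2 := by gcongr
    have e4 : Rᵀ * R = Rᵀ * ((1 - Qᵀ * Q) * R) + (Q * R)ᵀ * (Q * R) := by
      simp only [Matrix.transpose_mul, Matrix.mul_sub, Matrix.sub_mul, Matrix.one_mul,
        Matrix.mul_assoc]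
      abel
    have e5 := norm_add_le (Rᵀ * ((1 - Qᵀ * Q) * R)) ((Q * R)ᵀ * (Q * R))
    rw [← e4, norm_transpose_mul_self, norm_transpose_mul_self] at e5
    nlinarith [sq_nonneg ‖R‖]
  have e2 : Rᵀ * R - Xᵀ * X = Rᵀ * ((1 - Qᵀ * Q) * R) +
      (Xᵀ * (Q * R - X) + (Q * R - X)ᵀ * X + (Q * R - X)ᵀ * (Q * R - X)) := by
    simp only [Matrix.transpose_mul, Matrix.transpose_sub, Matrix.mul_sub, Matrix.sub_mul,
      Matrix.one_mul, Matrix.mul_assoc]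
    abel
  have e3 : ‖Xᵀ * (Q * R - X)‖ ≤ ‖X‖ * (ρ * ‖X‖) := norm_transpose_mul_le le_rfl hr
  have e4 : ‖(Q * R - X)ᵀ * X‖ ≤ ρ * ‖X‖ * ‖X‖ := norm_transpose_mul_le hr le_rfl
  have e5 : ‖(Q * R - X)ᵀ * (Q * R - X)‖ ≤ ρ * ‖X‖ * (ρ * ‖X‖) := norm_transpose_mul_le hr hr
  have e6 := norm_add_le (Rᵀ * ((1 - Qᵀ * Q) * R))
    (Xᵀ * (Q * R - X) + (Q * R - X)ᵀ * X + (Q * R - X)ᵀ * (Q * R - X))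
  have e7 := norm_add₃_le (a := Xᵀ * (Q * R - X)) (b := (Q * R - X)ᵀ * X)
    (c := (Q * R - X)ᵀ * (Q * R - X))
  rw [← e2] at e6
  have e8 : δ * ‖R‖ ^ 2 ≤ δ * (2 * ‖X‖ ^ 2) := by gcongr
  have e9 : ρ * (ρ * ‖X‖ ^ 2) ≤ 1 * (ρ * ‖X‖ ^ 2) := by gcongr; linarith
  nlinarith

/-! ### Splitting off the last block column -/

section Blocks

variable {m p s : ℕ}

/-- The part of the `k`-th block column of `R` above the diagonal block. -/
def offBlock (R : Matrix (Fin p × Fin s) (Fin p × Fin s) ℝ) (k : ℕ) (hk : k < p) :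
    Matrix (Fin k × Fin s) (Fin s) ℝ :=
  fun j b => R (Fin.castLE hk.le j.1, j.2) (⟨k, hk⟩, b)

/-- The embedding of the first `k` block columns into the first `k + 1`. -/
def leadIdx (s k : ℕ) : Fin k × Fin s → Fin (k + 1) × Fin s := Prod.map Fin.castSucc id

/-- The embedding of the last block column into the first `k + 1`. -/
def lastIdx (s k : ℕ) : Fin s → Fin (k + 1) × Fin s := fun a => (Fin.last k, a)

theorem leadIdx_injective (s k : ℕ) : (leadIdx s k).Injective :=
  (Fin.castSucc_injective k).prodMap Function.injective_id

theorem lastIdx_injective (s k : ℕ) : (lastIdx s k).Injective := fun a b h => by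
  simpa [lastIdx] using h

theorem leadIdx_ne_lastIdx (s k : ℕ) (a : Fin k × Fin s) (b : Fin s) :
    leadIdx s k a ≠ lastIdx s k b := by
  simp [leadIdx, lastIdx, Prod.ext_iff, Fin.castSucc_ne_last]

theorem leadIdx_or_lastIdx (s k : ℕ) (c : Fin (k + 1) × Fin s) :
    (∃ a, leadIdx s k a = c) ∨ ∃ b, lastIdx s k b = c := by
  obtain ⟨i, a⟩ := c
  induction i using Fin.lastCases with
  | last => exact Or.inr ⟨a, rfl⟩
  | cast i => exact Or.inl ⟨(i, a), rfl⟩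

theorem leadCols_submatrix_leadIdx (X : Matrix (Fin m) (Fin p × Fin s) ℝ) {k : ℕ} (hk : k < p) :
    (leadCols X (k + 1) hk).submatrix id (leadIdx s k) = leadCols X k hk.le := rfl

theorem leadCols_submatrix_lastIdx (X : Matrix (Fin m) (Fin p × Fin s) ℝ) {k : ℕ} (hk : k < p) :
    (leadCols X (k + 1) hk).submatrix id (lastIdx s k) = colBlock X ⟨k, hk⟩ := rfl

theorem leadCols_mul_leadBlock_submatrix_leadIdx (Q : Matrix (Fin m) (Fin p × Fin s) ℝ)
    {R : Matrix (Fin p × Fin s) (Fin p × Fin s) ℝ}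
    (hR : ∀ k i : Fin p, k < i → ∀ a b : Fin s, R (i, a) (k, b) = 0) {k : ℕ} (hk : k < p) :
    (leadCols Q (k + 1) hk * leadBlock R (k + 1) hk).submatrix id (leadIdx s k) =
      leadCols Q k hk.le * leadBlock R k hk.le := by
  ext r ⟨i, b⟩
  simp only [Matrix.submatrix_apply, Matrix.mul_apply, Fintype.sum_prod_type,
    Fin.sum_univ_castSucc]
  have : ∀ a, leadBlock R (k + 1) hk (Fin.last k, a) (leadIdx s k (i, b)) = 0 := fun a =>
    hR (Fin.castLE hk i.castSucc) (Fin.castLE hk (Fin.last k)) (by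
      simp [Fin.lt_def]) a b
  simp only [this, mul_zero, Finset.sum_const_zero, add_zero]
  rfl

theorem leadCols_mul_leadBlock_submatrix_lastIdx (Q : Matrix (Fin m) (Fin p × Fin s) ℝ)
    (R : Matrix (Fin p × Fin s) (Fin p × Fin s) ℝ) {k : ℕ} (hk : k < p) :
    (leadCols Q (k + 1) hk * leadBlock R (k + 1) hk).submatrix id (lastIdx s k) =
      leadCols Q k hk.le * offBlock R k hk + colBlock Q ⟨k, hk⟩ * diagBlock R ⟨k, hk⟩ := by
  ext r b
  simp only [Matrix.submatrix_apply, Matrix.mul_apply, Matrix.add_apply, Fintype.sum_prod_type,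
    Fin.sum_univ_castSucc]
  rfl

theorem norm_leadCols_le_succ (X : Matrix (Fin m) (Fin p × Fin s) ℝ) {k : ℕ} (hk : k < p) :
    ‖leadCols X k hk.le‖ ≤ ‖leadCols X (k + 1) hk‖ := by
  rw [← leadCols_submatrix_leadIdx]
  exact norm_submatrix_cols_le _ (leadIdx_injective s k)

theorem norm_colBlock_le (X : Matrix (Fin m) (Fin p × Fin s) ℝ) {k : ℕ} (hk : k < p) :
    ‖colBlock X ⟨k, hk⟩‖ ≤ ‖leadCols X (k + 1) hk‖ := by
  rw [← leadCols_submatrix_lastIdx]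
  exact norm_submatrix_cols_le _ (lastIdx_injective s k)

theorem castLE_prodMap_injective {k : ℕ} (hk : k ≤ p) :
    (Prod.map (Fin.castLE hk) id : Fin k × Fin s → Fin p × Fin s).Injective :=
  (Fin.castLE_injective hk).prodMap Function.injective_id

theorem norm_leadCols_le (X : Matrix (Fin m) (Fin p × Fin s) ℝ) {k : ℕ} (hk : k ≤ p) :
    ‖leadCols X k hk‖ ≤ ‖X‖ :=
  norm_submatrix_cols_le _ (castLE_prodMap_injective hk)

theorem residual_succ_le {Q X : Matrix (Fin m) (Fin p × Fin s) ℝ}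
    {R : Matrix (Fin p × Fin s) (Fin p × Fin s) ℝ}
    (hR : ∀ k i : Fin p, k < i → ∀ a b : Fin s, R (i, a) (k, b) = 0) {k : ℕ} (hk : k < p) :
    ‖leadCols Q (k + 1) hk * leadBlock R (k + 1) hk - leadCols X (k + 1) hk‖ ≤
      ‖leadCols Q k hk.le * leadBlock R k hk.le - leadCols X k hk.le‖ +
      ‖leadCols Q k hk.le * offBlock R k hk + colBlock Q ⟨k, hk⟩ * diagBlock R ⟨k, hk⟩ -
        colBlock X ⟨k, hk⟩‖ := by
  have := norm_le_add_cols (leadCols Q (k + 1) hk * leadBlock R (k + 1) hk - leadCols X (k + 1) hk)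
    (leadIdx_injective s k) (lastIdx_injective s k) (leadIdx_ne_lastIdx s k)
    (leadIdx_or_lastIdx s k)
  simp only [Matrix.submatrix_sub, Pi.sub_apply] at this
  rwa [leadCols_mul_leadBlock_submatrix_leadIdx Q hR hk,
    leadCols_mul_leadBlock_submatrix_lastIdx Q R hk, leadCols_submatrix_leadIdx,
    leadCols_submatrix_lastIdx] at this

theorem orthogonality_succ_le (Q : Matrix (Fin m) (Fin p × Fin s) ℝ) {k : ℕ} (hk : k < p) :
    ‖1 - (leadCols Q (k + 1) hk)ᵀ * leadCols Q (k + 1) hk‖ ≤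
      ‖1 - (leadCols Q k hk.le)ᵀ * leadCols Q k hk.le‖ +
      ‖1 - (colBlock Q ⟨k, hk⟩)ᵀ * colBlock Q ⟨k, hk⟩‖ +
      2 * ‖(leadCols Q k hk.le)ᵀ * colBlock Q ⟨k, hk⟩‖ := by
  have := norm_one_sub_gram_le (leadCols Q (k + 1) hk) (leadIdx_injective s k)
    (lastIdx_injective s k) (leadIdx_ne_lastIdx s k) (leadIdx_or_lastIdx s k)
  rwa [leadCols_submatrix_leadIdx, leadCols_submatrix_lastIdx] at this

theorem FlSubDot.of_map {ι κ : Type} {u a c : ℝ} {I : Finset ι} {f : ι ↪ κ} {x y : κ → ℝ}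
    (h : FlSubDot u a (I.map f) x y c) : FlSubDot u a I (x ∘ f) (y ∘ f) c := by
  obtain ⟨q, hq, hc⟩ := h
  refine ⟨q ∘ f, fun i hi => hq _ (Finset.mem_map_of_mem f hi), ?_⟩
  simpa [Finset.map_val, Multiset.map_map, Function.comp_def] using hc

theorem prevCols_eq_map (s : ℕ) {k : ℕ} (hk : k < p) :
    prevCols s (⟨k, hk⟩ : Fin p) = (Finset.univ : Finset (Fin k × Fin s)).map
      ⟨Prod.map (Fin.castLE hk.le) id, castLE_prodMap_injective hk.le⟩ := by
  ext ⟨i, a⟩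
  simp only [prevCols, Finset.mem_product, Finset.mem_Iio, Finset.mem_univ, and_true,
    Finset.mem_map, true_and, Function.Embedding.coeFn_mk, Prod.exists, Prod.map_apply,
    Prod.mk.injEq, id]
  constructor
  · intro h
    exact ⟨⟨i, h⟩, a, rfl, rfl⟩
  · rintro ⟨j, b, rfl, rfl⟩
    exact j.isLt

end Blocks

/-! ### Accuracy of the leading block columns of a run -/

namespace PIPIRun

variable {m p s : ℕ} {εl εh : ℝ} {orth : IntraOrth m s} {X : Matrix (Fin m) (Fin p × Fin s) ℝ}

theorem pip_first (run : PIPIRun εl εh orth X) {k : ℕ} (hk : k < p) (hk0 : 0 < k) :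
    FlPIP εl εh (leadCols run.Q k hk.le) (colBlock X ⟨k, hk⟩) (colBlock run.V ⟨k, hk⟩)
      (colBlock run.U ⟨k, hk⟩) (offBlock run.S k hk) (diagBlock run.S ⟨k, hk⟩) (run.Ω ⟨k, hk⟩)
      (run.A ⟨k, hk⟩) (run.d ⟨k, hk⟩) where
  S_eq i b := run.S_off ⟨k, hk⟩ (Fin.castLE hk.le i.1) i.1.isLt i.2 b
  Ω_eq := run.Ω_eq ⟨k, hk⟩ hk0
  A_eq a b := by
    have := run.A_eq ⟨k, hk⟩ hk0 a b
    rw [prevCols_eq_map] at this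
    exact this.of_map
  chol := run.S_diag ⟨k, hk⟩ hk0
  V_eq r b := by
    have := run.V_eq ⟨k, hk⟩ hk0 r b
    rw [prevCols_eq_map] at this
    exact this.of_map
  U_eq := run.U_eq ⟨k, hk⟩ hk0

theorem pip_second (run : PIPIRun εl εh orth X) {k : ℕ} (hk : k < p) (hk0 : 0 < k) :
    FlPIP εl εh (leadCols run.Q k hk.le) (colBlock run.U ⟨k, hk⟩) (colBlock run.W ⟨k, hk⟩)
      (colBlock run.Q ⟨k, hk⟩) (offBlock run.T k hk) (diagBlock run.T ⟨k, hk⟩) (run.P ⟨k, hk⟩)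
      (run.B ⟨k, hk⟩) (run.e ⟨k, hk⟩) where
  S_eq i b := run.T_off ⟨k, hk⟩ (Fin.castLE hk.le i.1) i.1.isLt i.2 b
  Ω_eq := run.P_eq ⟨k, hk⟩ hk0
  A_eq a b := by
    have := run.B_eq ⟨k, hk⟩ hk0 a b
    rw [prevCols_eq_map] at this
    exact this.of_map
  chol := run.T_diag ⟨k, hk⟩ hk0
  V_eq r b := by
    have := run.W_eq ⟨k, hk⟩ hk0 r b
    rw [prevCols_eq_map] at this
    exact this.of_map
  U_eq := run.Q_eq ⟨k, hk⟩ hk0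

/-- The first `k` block columns are orthonormal and a factor of `X` up to the expected error. -/
structure Accurate (run : PIPIRun εl εh orth X) (η : ℝ) (k : ℕ) (hk : k ≤ p) : Prop where
  orthogonality : ‖1 - (leadCols run.Q k hk)ᵀ * leadCols run.Q k hk‖ ≤ 20200 * k * η
  residual : ‖leadCols run.Q k hk * leadBlock run.R k hk - leadCols X k hk‖ ≤
    150 * k * η * ‖leadCols X k hk‖

variable {γ η σ D : ℝ} {h : ℕ}

/-- The increments do not depend on `k`: orthogonality grows by `19600 + 2 · 300 = 20200` units, and
the residual by `140` units from the two projections plus `2 + 3/2` from assembling `R`, within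
`150`. -/
theorem Accurate.step {run : PIPIRun εl εh orth X} {k : ℕ} {hk : k < p} (hk0 : 0 < k)
    (hs0 : 0 < s) (acc : run.Accurate η k hk.le) (H : ErrUnit εl εh γ η h) (hm : m ≤ h)
    (hps : p * s ≤ h) (hσ : 0 < σ) (hX : LowerBound σ X) (hD : 20200 * p ≤ D)
    (hsmall : 1000000 * D ^ 2 * η * ‖X‖ ^ 2 ≤ σ ^ 2) :
    (∀ j, 0 < run.d ⟨k, hk⟩ j ∧ 0 < run.e ⟨k, hk⟩ j) ∧ run.Accurate η (k + 1) hk := by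
  have hη := H.η_nonneg
  have hη1 := H.small
  have hp : 1 ≤ p := by omega
  have hp1 : (1 : ℝ) ≤ p := by exact_mod_cast hp
  have hkp : (k : ℝ) ≤ p := by exact_mod_cast hk.le
  have hD1 : 1 ≤ D := by linarith
  have hs : s ≤ h := le_trans (Nat.le_mul_of_pos_left s hp) hps
  have hι : Fintype.card (Fin k × Fin s) ≤ h := by
    simpa using le_trans (Nat.mul_le_mul_right s hk.le) hps
  have : Nonempty (Fin s) := ⟨⟨0, hs0⟩⟩
  have hXk : LowerBound σ (leadCols X (k + 1) hk) := hX.submatrix (castLE_prodMap_injective hk)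
  have hσN : σ ≤ ‖leadCols X (k + 1) hk‖ := hXk.le_norm
  have hNX : ‖leadCols X (k + 1) hk‖ ≤ ‖X‖ := norm_leadCols_le X hk
  have hNk : ‖leadCols X k hk.le‖ ≤ ‖leadCols X (k + 1) hk‖ := norm_leadCols_le_succ X hk
  have hXb : ‖colBlock X ⟨k, hk⟩‖ ≤ ‖leadCols X (k + 1) hk‖ := norm_colBlock_le X hk
  set N := ‖leadCols X (k + 1) hk‖
  have hN : 0 < N := hσ.trans_le hσN
  have hsmallN : 1000000 * D ^ 2 * η * N ^ 2 ≤ σ ^ 2 := le_trans (by gcongr) hsmall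
  have hδ : 20200 * k * η ≤ D * η := by
    gcongr
    linarith
  have hr : ‖leadCols run.Q k hk.le * leadBlock run.R k hk.le - leadCols X k hk.le‖ < σ / 2 := by
    have e1 : 150 * k * η * ‖leadCols X k hk.le‖ ≤ D * η * N := by
      gcongr
      linarith
    have e2 : D * η * N * σ ≤ D ^ 2 * η * N ^ 2 := by
      calc D * η * N * σ ≤ D * η * N * N := by gcongr
        _ = 1 * (D * η * N ^ 2) := by ring
        _ ≤ D * (D * η * N ^ 2) := by gcongr
        _ = _ := by ring
    have e3 : σ * (D * η * N) < σ * (σ / 2) := by nlinarith [sq_pos_of_pos hσ]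
    have e4 := lt_of_mul_lt_mul_left e3 hσ.le
    exact (acc.residual.trans e1).trans_lt e4
  have hlow := hXk.sub_mul hσ (leadIdx_injective s k) (lastIdx_injective s k)
    (leadIdx_ne_lastIdx s k) (Q := leadCols run.Q k hk.le) (R := leadBlock run.R k hk.le)
    hr (offBlock run.S k hk)
  obtain ⟨hpiv, hS, hT, hG, hG', hQ', hQQ, hQQ', hres⟩ :=
    (run.pip_first hk hk0).project_twice (run.pip_second hk hk0) H hm hs hι acc.orthogonality
      hD1 hδ hXb hσ hσN hlow hsmallN
  obtain ⟨hRo, hRd⟩ := assembly_bound (Ro := offBlock run.R k hk)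
    (Rd := diagBlock run.R ⟨k, hk⟩) H hs hι hN.le hS hT hG hG'
    (run.Slow_eq ⟨k, hk⟩ hk0)
    (fun i b => run.R_off ⟨k, hk⟩ (Fin.castLE hk.le i.1) i.1.isLt i.2 b)
    (run.R_diag ⟨k, hk⟩ hk0)
  refine ⟨hpiv, ?_, ?_⟩
  · have e1 := orthogonality_succ_le run.Q hk
    have e2 := acc.orthogonality
    push_cast
    linarith
  · have e1 := residual_succ_le (Q := run.Q) (X := X) run.R_lower hk
    have e2 := acc.residual
    have hQ2 : ‖leadCols run.Q k hk.le‖ ≤ 2 := by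
      refine norm_le_of_one_sub_gram (acc.orthogonality.trans hδ) zero_le_two ?_
      have : 1000000 * (D * η) * N ^ 2 ≤ 1 * N ^ 2 := by
        calc 1000000 * (D * η) * N ^ 2 ≤ 1000000 * (D * (D * η)) * N ^ 2 := by
              gcongr
              exact le_mul_of_one_le_left (by positivity) hD1
          _ = 1000000 * D ^ 2 * η * N ^ 2 := by ring
          _ ≤ σ ^ 2 := hsmallN
          _ ≤ 1 * N ^ 2 := by rw [one_mul]; gcongr
      have := le_of_mul_le_mul_right this (by positivity)
      linarith
    have e3 : leadCols run.Q k hk.le * offBlock run.R k hk +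
        colBlock run.Q ⟨k, hk⟩ * diagBlock run.R ⟨k, hk⟩ - colBlock X ⟨k, hk⟩ =
        leadCols run.Q k hk.le * (offBlock run.R k hk -
          (offBlock run.S k hk + offBlock run.T k hk * diagBlock run.S ⟨k, hk⟩)) +
        colBlock run.Q ⟨k, hk⟩ * (diagBlock run.R ⟨k, hk⟩ -
          diagBlock run.T ⟨k, hk⟩ * diagBlock run.S ⟨k, hk⟩) +
        (leadCols run.Q k hk.le * (offBlock run.S k hk +
            offBlock run.T k hk * diagBlock run.S ⟨k, hk⟩) +
          colBlock run.Q ⟨k, hk⟩ * (diagBlock run.T ⟨k, hk⟩ * diagBlock run.S ⟨k, hk⟩) -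
          colBlock X ⟨k, hk⟩) := by
      simp only [Matrix.mul_sub]
      abel
    have e4 : ‖leadCols run.Q k hk.le * offBlock run.R k hk +
        colBlock run.Q ⟨k, hk⟩ * diagBlock run.R ⟨k, hk⟩ - colBlock X ⟨k, hk⟩‖ ≤
        150 * (η * N) := by
      rw [e3]
      refine norm_add₃_le.trans ?_
      have f1 := norm_mul_le_of_le hQ2 hRo
      have f2 := norm_mul_le_of_le hQ' hRd
      have : 0 ≤ η * N := by positivity
      linarith
    have e5 : 150 * k * η * ‖leadCols X k hk.le‖ ≤ 150 * k * η * N := by gcongr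
    push_cast
    linarith

theorem accurate_zero (run : PIPIRun εl εh orth X) : run.Accurate η 0 (Nat.zero_le p) := by
  constructor
  · rw [Subsingleton.elim (1 - _) (0 : Matrix (Fin 0 × Fin s) (Fin 0 × Fin s) ℝ)]; simp
  · rw [Subsingleton.elim (_ - _) (0 : Matrix (Fin m) (Fin 0 × Fin s) ℝ)]; simp

/-- The inequalities for appending a block, applied to the empty factorization, whose errors vanish.
-/
theorem accurate_one (run : PIPIRun εl εh orth X) (hp : 0 < p) (hη : 0 ≤ η)
    (hQ : ‖1 - (colBlock run.Q ⟨0, hp⟩)ᵀ * colBlock run.Q ⟨0, hp⟩‖ ≤ η)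
    (hR : ‖colBlock run.Q ⟨0, hp⟩ * diagBlock run.R ⟨0, hp⟩ - colBlock X ⟨0, hp⟩‖ ≤
      η * ‖colBlock X ⟨0, hp⟩‖) : run.Accurate η 1 hp := by
  have acc := run.accurate_zero (η := η)
  constructor
  · have e1 := orthogonality_succ_le run.Q hp
    have e2 := acc.orthogonality
    rw [Subsingleton.elim ((leadCols run.Q 0 hp.le)ᵀ * colBlock run.Q ⟨0, hp⟩) 0, norm_zero] at e1
    simp only [Nat.cast_zero, Nat.cast_one, mul_zero, zero_mul] at e2 ⊢
    linarith
  · have e1 := residual_succ_le (Q := run.Q) (X := X) run.R_lower hp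
    have e2 := acc.residual
    have e3 : leadCols run.Q 0 hp.le * offBlock run.R 0 hp = 0 := by
      ext; simp [Matrix.mul_apply]
    rw [e3, zero_add (colBlock _ _ * _)] at e1
    have e4 : η * ‖colBlock X ⟨0, hp⟩‖ ≤ η * ‖leadCols X 1 hp‖ := by
      gcongr
      exact norm_colBlock_le X hp
    have e5 : 0 ≤ η * ‖leadCols X 1 hp‖ := by positivity
    simp only [Nat.cast_zero, Nat.cast_one, mul_zero, zero_mul] at e2 ⊢
    linarith

theorem accurate_of_one {run : PIPIRun εl εh orth X} {hp : 0 < p} (acc : run.Accurate η 1 hp)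
    (hs0 : 0 < s) (H : ErrUnit εl εh γ η h) (hm : m ≤ h)
    (hps : p * s ≤ h) (hσ : 0 < σ) (hX : LowerBound σ X) (hD : 20200 * p ≤ D)
    (hsmall : 1000000 * D ^ 2 * η * ‖X‖ ^ 2 ≤ σ ^ 2) :
    run.NoBreakdown ∧ ∀ (k : ℕ) (hk : k ≤ p), 1 ≤ k → run.Accurate η k hk := by
  have hacc : ∀ (k : ℕ) (hk : k ≤ p), 1 ≤ k → run.Accurate η k hk := by
    intro k hk hk1
    induction k, hk1 using Nat.le_induction with
    | base => exact acc
    | succ k hk1 ih => exact ((ih (by omega)).step hk1 hs0 H hm hps hσ hX hD hsmall).2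
  exact ⟨fun k hk => ((hacc k k.isLt.le hk).step (hk := k.isLt) hk hs0 H hm hps hσ hX hD hsmall).1,
    hacc⟩

end PIPIRun

/-! ### The dimensional constants -/

section Constants

open MvPolynomial

/-- The ratio of the error unit to the low precision. -/
noncomputable def unitPoly (bD bN bM : MvPolynomial (Fin 2) ℝ) : MvPolynomial (Fin 2) ℝ :=
  C 2000 * (X 0 + X 1) ^ 3 * (X 0 + X 1 + C 2) * (1 + bD ^ 2 + bN ^ 2 + bM ^ 2)

theorem dimConst_unitPoly (bD bN bM : MvPolynomial (Fin 2) ℝ) (m p s : ℕ) :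
    dimConst (unitPoly bD bN bM) m p s =
      2000 * ((m + p * s : ℕ) : ℝ) ^ 3 * (((m + p * s : ℕ) : ℝ) + 2) *
        (1 + dimConst bD m p s ^ 2 + dimConst bN m p s ^ 2 + dimConst bM m p s ^ 2) := by
  simp [dimConst, unitPoly]

/-- The bound for the loss of orthogonality, in error units. -/
noncomputable def orthPoly : MvPolynomial (Fin 2) ℝ := C 20200 * X 1

theorem dimConst_orthPoly (m p s : ℕ) : dimConst orthPoly m p s = 20200 * (p * s : ℕ) := by
  simp [dimConst, orthPoly]

theorem dimConst_mul (a b : MvPolynomial (Fin 2) ℝ) (m p s : ℕ) :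
    dimConst (a * b) m p s = dimConst a m p s * dimConst b m p s := by
  simp [dimConst]

theorem dimConst_C (a : ℝ) (m p s : ℕ) : dimConst (C a) m p s = a := by
  simp [dimConst]

end Constants

/-- Dimensional constants may be negative and polynomials have no absolute value; `2 |b| ≤ 1 + b²`
lets a sum of squares dominate them all. The factor `2` for `bN` pays for the denominator in the
bound assumed of the routine, which is at least `1/2`. -/
theorem unit_bounds {h ε β bD bN bM g : ℝ} (hh : 1 ≤ h) (hε : 0 ≤ ε)
    (hβ : β = 1 + bD ^ 2 + bN ^ 2 + bM ^ 2) (hg : g = 2000 * h ^ 3 * (h + 2) * β) :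
    1 ≤ g ∧ bD * ε ≤ g * ε ∧ |bN| * 2 ≤ g ∧ bM ≤ g ∧
      1000 * h ^ 3 * (2 * (h + 2) * ε) ≤ g * ε ∧ (h + 2) * ε ≤ g * ε := by
  have hβ1 : 1 ≤ β := by rw [hβ]; nlinarith [sq_nonneg bD, sq_nonneg bN, sq_nonneg bM]
  have h3 : 1 ≤ h ^ 3 := one_le_pow₀ hh
  have hA : h + 2 ≤ 2000 * h ^ 3 * (h + 2) := le_mul_of_one_le_left (by linarith) (by linarith)
  have hA0 : 0 ≤ 2000 * h ^ 3 * (h + 2) := by positivity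
  have hgA : 2000 * h ^ 3 * (h + 2) ≤ g := by rw [hg]; exact le_mul_of_one_le_right hA0 hβ1
  have hgβ : β ≤ g := by
    rw [hg]; exact le_mul_of_one_le_left (by linarith) (by linarith)
  refine ⟨by linarith, ?_, ?_, ?_, ?_, ?_⟩
  · gcongr
    nlinarith [sq_nonneg (bD - 1), sq_nonneg bN, sq_nonneg bM]
  · nlinarith [sq_nonneg (|bN| - 1), sq_abs bN, sq_nonneg bD, sq_nonneg bM]
  · nlinarith [sq_nonneg (bM - 1), sq_nonneg bN, sq_nonneg bD]
  · calc _ = 2000 * h ^ 3 * (h + 2) * ε := by ring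
      _ ≤ _ := by gcongr
  · gcongr
    linarith

/-- The orthogonality bound assumed of the routine for the first block, in error units. -/
theorem first_block_bound {bN bM ε κ g x : ℝ} (hε : 0 ≤ ε) (hN : |bN| * 2 ≤ g)
    (hM : bM * ε * κ ^ 2 ≤ 1 / 2) (hx : x ≤ bN * ε / (1 - bM * ε * κ ^ 2)) : x ≤ g * ε := by
  have h1 : 0 < 1 - bM * ε * κ ^ 2 := by linarith
  refine hx.trans ?_
  rw [div_le_iff₀ h1]
  have h2 : bN * ε ≤ g / 2 * ε := by
    gcongr
    linarith [le_abs_self bN]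
  have h3 : 0 ≤ g := by linarith [abs_nonneg bN]
  have h4 : g * ε * (1 / 2) ≤ g * ε * (1 - bM * ε * κ ^ 2) := by
    gcongr
    linarith
  linarith

end BlockGS

/-! ### Assembly of the theorem -/

theorem mainTheorem9
    -- the dimensional constants in the four bounds assumed of the intraorthogonalization
    (bE bD bN bM : MvPolynomial (Fin 2) ℝ) :
    -- the dimensional constants of the theorem: `C` in the condition on `κ` and in the denominator
    ∃ C cE cD cN cL : MvPolynomial (Fin 2) ℝ,
    ∀ (m p s : ℕ), 0 < p → 0 < s →
    ∀ (εl εh : ℝ), 0 < εh → εh ≤ εl →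
    ∀ X : Matrix (Fin m) (Fin p × Fin s) ℝ, BlockGS.HasFullColumnRank X →
    BlockGS.dimConst C m p s * εl * BlockGS.cond X ^ 2 ≤ 1 / 2 →
    ∀ orth : BlockGS.IntraOrth m s,
    (∀ Y : Matrix (Fin m) (Fin s) ℝ, BlockGS.HasFullColumnRank Y →
      BlockGS.cond Y ≤ BlockGS.cond X →
      ‖(orth Y).2ᵀ * (orth Y).2 - Yᵀ * Y‖ ≤ BlockGS.dimConst bE m p s * εl * ‖Y‖ ^ 2 ∧
      ‖(orth Y).1 * (orth Y).2 - Y‖ ≤ BlockGS.dimConst bD m p s * εl * ‖Y‖ ∧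
      ‖1 - (orth Y).1ᵀ * (orth Y).1‖ ≤
        BlockGS.dimConst bN m p s * εl /
          (1 - BlockGS.dimConst bM m p s * εl * BlockGS.cond Y ^ 2)) →
    ∀ run : BlockGS.PIPIRun εl εh orth X,
    run.NoBreakdown ∧
    ∀ (k : ℕ) (hk : k ≤ p), 1 ≤ k →
      ‖(BlockGS.leadBlock run.R k hk)ᵀ * BlockGS.leadBlock run.R k hk -
          (BlockGS.leadCols X k hk)ᵀ * BlockGS.leadCols X k hk‖ ≤
        BlockGS.dimConst cE m p s * εl * ‖BlockGS.leadCols X k hk‖ ^ 2 ∧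
      ‖BlockGS.leadCols run.Q k hk * BlockGS.leadBlock run.R k hk - BlockGS.leadCols X k hk‖ ≤
        BlockGS.dimConst cD m p s * εl * ‖BlockGS.leadCols X k hk‖ ∧
      ‖1 - (BlockGS.leadCols run.Q k hk)ᵀ * BlockGS.leadCols run.Q k hk‖ ≤
        BlockGS.dimConst cN m p s * εl /
          (1 - BlockGS.dimConst C m p s * εl * BlockGS.cond (BlockGS.leadCols X k hk) ^ 2) ∧
      BlockGS.dimConst cN m p s * εl /
          (1 - BlockGS.dimConst C m p s * εl * BlockGS.cond (BlockGS.leadCols X k hk) ^ 2) ≤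
        BlockGS.dimConst cL m p s * εl := by
  open BlockGS in
  -- With `D = 20200 p s`, the first constant is `4000000 D² g`, so the hypothesis reads `8000000 D²
  -- η κ² ≤ 1`; this exceeds the `1000000` needed by the induction and makes `D η` small. The
  -- polynomials see only `p s`, which bounds the number of blocks. The factor `5` is the `2 + 3` of
  -- `gram_bound`.
  refine ⟨MvPolynomial.C 4000000 * (orthPoly * orthPoly * unitPoly bD bN bM),
    MvPolynomial.C 5 * (orthPoly * unitPoly bD bN bM), orthPoly * unitPoly bD bN bM,
    orthPoly * unitPoly bD bN bM, MvPolynomial.C 2 * (orthPoly * unitPoly bD bN bM), ?_⟩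
  intro m p s hp hs εl εh hεh hεl X hX hC orth horth run
  simp only [dimConst_mul, dimConst_C, dimConst_unitPoly, dimConst_orthPoly] at hC ⊢
  set n : ℕ := p * s
  set h : ℕ := m + n with hh
  have hpn : p ≤ n := Nat.le_mul_of_pos_right p hs
  have hh1 : 1 ≤ h := by omega
  have hh1' : (1 : ℝ) ≤ h := by exact_mod_cast hh1
  have hp1 : (1 : ℝ) ≤ p := by exact_mod_cast hp
  have hpn' : (p : ℝ) ≤ n := by exact_mod_cast hpn
  have hε : 0 < εl := hεh.trans_le hεl
  set g : ℝ := 2000 * (h : ℝ) ^ 3 * (h + 2) *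
    (1 + dimConst bD m p s ^ 2 + dimConst bN m p s ^ 2 + dimConst bM m p s ^ 2) with hg
  set D : ℝ := 20200 * (n : ℝ) with hDdef
  obtain ⟨hg1, hgD, hgN, hgM, hgγ, hgh⟩ := unit_bounds (h := (h : ℝ)) hh1' hε.le rfl hg
  clear_value g
  have : Nonempty (Fin s) := ⟨⟨0, hs⟩⟩
  have : Nonempty (Fin p) := ⟨⟨0, hp⟩⟩
  obtain ⟨σ, hσ, hσX, hlow, hcond, -⟩ := hX.exists_cond_eq
  have hκ1 : 1 ≤ cond X := by rw [hcond, le_div_iff₀ hσ]; linarith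
  have hD1 : 1 ≤ D := by linarith
  set η : ℝ := g * εl with hη
  have hη0 : 0 < η := by positivity
  have hκ2 : 1 ≤ cond X ^ 2 := one_le_pow₀ hκ1
  -- consequences of the condition on `κ`
  have hDκ : 8000000 * (D ^ 2 * η * cond X ^ 2) ≤ 1 := by
    rw [hη]; linarith
  have hηκ : η * cond X ^ 2 ≤ D ^ 2 * η * cond X ^ 2 := by
    gcongr
    exact le_mul_of_one_le_left hη0.le (one_le_pow₀ hD1)
  have hDη : D * η ≤ D ^ 2 * η * cond X ^ 2 := by
    calc D * η = D * 1 * η * 1 := by ring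
      _ ≤ D * D * η * cond X ^ 2 := by gcongr
      _ = _ := by ring
  have hηη : η ≤ η * cond X ^ 2 := le_mul_of_one_le_right hη0.le hκ2
  have hH : ErrUnit εl εh (2 * (h + 2) * εl) η h := by
    have : (h + 2) * εl ≤ 1 := by linarith
    exact ⟨dotBound_of_le hε.le le_rfl this, dotBound_of_le hεh.le hεl this, hh1, hgγ, by linarith⟩
  have hsmall : 1000000 * D ^ 2 * η * ‖X‖ ^ 2 ≤ σ ^ 2 := by
    rw [hcond, div_pow] at hDκ
    have e1 : 8000000 * (D ^ 2 * η * (‖X‖ ^ 2 / σ ^ 2)) =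
        8000000 * (D ^ 2 * η * ‖X‖ ^ 2) / σ ^ 2 := by ring
    rw [e1, div_le_one (by positivity)] at hDκ
    have : 0 ≤ D ^ 2 * η * ‖X‖ ^ 2 := by positivity
    linarith
  -- the first block
  have hacc1 : run.Accurate η 1 hp := by
    have hf : Function.Injective (fun a : Fin s => ((⟨0, hp⟩ : Fin p), a)) :=
      fun a b hab => by simpa using hab
    have hrank : HasFullColumnRank (colBlock X ⟨0, hp⟩) := hX.submatrix hf
    have hcd : 0 ≤ cond (colBlock X ⟨0, hp⟩) ∧ cond (colBlock X ⟨0, hp⟩) ≤ cond X :=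
      cond_submatrix_le hX hf
    obtain ⟨-, h2, h3⟩ := horth _ hrank hcd.2
    rw [← run.first ⟨0, hp⟩ rfl] at h2 h3
    refine run.accurate_one hp hη0.le (first_block_bound hε.le hgN ?_ h3) (h2.trans ?_)
    · have : cond (colBlock X ⟨0, hp⟩) ^ 2 ≤ cond X ^ 2 := by
        have := hcd.1
        gcongr
        exact hcd.2
      calc dimConst bM m p s * εl * cond (colBlock X ⟨0, hp⟩) ^ 2
          ≤ g * εl * cond (colBlock X ⟨0, hp⟩) ^ 2 := by gcongr
        _ ≤ η * cond X ^ 2 := by gcongr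
        _ ≤ 1 / 2 := by linarith
    · gcongr
  obtain ⟨hnb, hacc⟩ := PIPIRun.accurate_of_one hacc1 hs hH (by omega) (by omega) hσ hlow
    (D := D) (by linarith) hsmall
  refine ⟨hnb, fun k hk hk1 => ?_⟩
  have hkn : (k : ℝ) ≤ n := by exact_mod_cast hk.trans hpn
  have hk0 : (0 : ℝ) ≤ k := k.cast_nonneg
  have hδ : 20200 * k * η ≤ D * η := by
    gcongr
    linarith
  have hρ : 150 * k * η ≤ D * η := by
    gcongr
    linarith
  have hQ := (hacc k hk hk1).orthogonality.trans hδ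
  have hR := (hacc k hk hk1).residual.trans (mul_le_mul_of_nonneg_right hρ (norm_nonneg _))
  have : Nonempty (Fin k) := ⟨⟨0, hk1⟩⟩
  have hck : 0 ≤ cond (leadCols X k hk) ∧ cond (leadCols X k hk) ≤ cond X :=
    cond_submatrix_le hX (castLE_prodMap_injective hk)
  have hck2 : cond (leadCols X k hk) ^ 2 ≤ cond X ^ 2 := by
    have := hck.1
    gcongr
    exact hck.2
  have hDη0 : 0 ≤ D * η := by positivity
  set t := 4000000 * (D * D * g) * εl * cond (leadCols X k hk) ^ 2 with ht
  have ht0 : 0 ≤ t := by positivity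
  have ht2 : t ≤ 1 / 2 := by
    refine le_trans ?_ hC
    rw [ht]
    gcongr
  have hDg : D * g * εl = D * η := by rw [hη]; ring
  rw [hDg]
  refine ⟨?_, hR, hQ.trans ?_, ?_⟩
  · have := gram_bound hQ (by linarith) hDη0 (by linarith) hR
    refine this.trans (le_of_eq ?_)
    rw [hη]; ring
  -- The loss of orthogonality is already at most `D η`; dividing by `1 - t`, which lies in `[1/2,
  -- 1]`, only weakens this, and by at most the factor `2` of the last constant.
  · exact (le_div_iff₀ (by linarith)).2 (mul_le_of_le_one_right hDη0 (by linarith))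
  · rw [show 2 * (D * g) * εl = D * η * 2 by rw [hη]; ring, div_eq_mul_inv]
    refine mul_le_mul_of_nonneg_left ?_ hDη0
    exact inv_le_of_inv_le₀ two_pos (by linarith)
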